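/- Let $K$ be an algebraically closed field and let $\mathcal C$ be a semisimple $K$-linear ribbon category in the sense of Turaev: a $K$-linear braided monoidal category with $K$-bilinear tensor product, duals and a twist $\theta$ satisfying $\theta_{X\otimes Y}=c_{Y,X}c_{X,Y}(\theta_X\otimes\theta_Y)$ and $\theta_{X^*}=(\theta_X)^*$, in which $\mathrm{End}(1\!\!1)=K$, there are no nonzero morphisms between non-isomorphic simple objects, and every object is dominated by simple objects (its identity is a finite sum of morphisms factoring through objects $S$ with $\mathrm{End}(S)=K$). Let $\dim X\in K$ denote the ribbon dimension, i.e. the ribbon trace of $\mathrm{id}_X$. Let $Z$ be a simple object which is self-dual, i.e. $1\!\!1$ is a direct summand of $Z\otimes Z$ with multiplicity one. Suppose $Z\otimes Z\cong\bigoplus_{i=1}^d Y_i$ with mutually non-isomorphic simple objects $Y_i$ such that $\dim Y_i\neq 0$, and suppose that the braiding $c=c_{Z,Z}$ acts on $Y_i$ by a scalar $\lambda_i$, with $\lambda_i\ne\lambda_j$ for $i\neq j$. For $a\in \mathrm{End}(Z^{\otimes 2})$ put $a_1=a\otimes 1$ and $a_2=1\otimes a$ in $\mathrm{End}(Z^{\otimes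 3})$. Let $p^{(i)}\in\mathrm{End}(Z^{\otimes 2})$ be the projection onto $Y_i$. (1) The space $V=\mathrm{Hom}(Z,Z^{\otimes 3})$, with $\sigma_j f=c_j\circ f$ for $j=1,2$, is a simple $d$-dimensional module of the braid group $B_3=\langle\sigma_1,\sigma_2\mid\sigma_1\sigma_2\sigma_1=\sigma_2\sigma_1\sigma_2\rangle$. For $j=1,2$ the eigenvalues of $\sigma_j$ on $V$ are exactly $\lambda_1,\dots,\lambda_d$, each of (algebraic) multiplicity $1$. (2) Some $Y_i$ is isomorphic to $1\!\!1$; label it $Y_1$. With $p=p^{(1)}$ one has $(\dim Y_i)\,p_2=(\dim Z)^2\,p_2\,(p^{(i)}\otimes 1)\,p_2$ for all $i$. (3) Let $A$ and $B$ be the endomorphisms of $V$ by which $\sigma_1$ and $\sigma_2$ act, and let $P^{(d)}_r(x)=\prod_{i\ne r}(x-\lambda_i)$. For all $r,s$ there is a unique scalar $Q^{(d)}_{rs}\in K$ with $P^{(d)}_r(A)P^{(d)}_s(B)P^{(d)}_r(A)=Q^{(d)}_{rs}P^{(d)}_r(A)$, and $$\dim Y_i=\frac{Q^{(d)}_{1i}\,(\dim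 Z)^2}{P^{(d)}_1(\lambda_1)\,P^{(d)}_i(\lambda_i)}\qquad (1\le i\le d).$$ For $r\neq s$ and $2\le d\le 5$ the scalars $Q^{(d)}_{rs}$ are given by $$Q^{(2)}_{rs}=-\lambda_r^2+\lambda_r\lambda_s-\lambda_s^2,\qquad Q^{(3)}_{rs}=(\lambda_r^2+\lambda_s\lambda_k)(\lambda_s^2+\lambda_r\lambda_k),$$ $$Q^{(4)}_{rs}=-\gamma^{-2}(\lambda_r^2+\gamma^2)(\lambda_s^2+\gamma^2)(\gamma^2+\lambda_r\lambda_k+\lambda_s\lambda_l)(\gamma^2+\lambda_r\lambda_l+\lambda_s\lambda_k),$$ $$Q^{(5)}_{rs}=\gamma^{-8}(\gamma^2+\lambda_r\gamma+\lambda_r^2)(\gamma^2+\lambda_s\gamma+\lambda_s^2)\prod_{k\ne r,s}(\gamma^2+\lambda_r\lambda_k)(\gamma^2+\lambda_s\lambda_k),$$ where $\{r,s,k\}=\{1,2,3\}$ for $d=3$ and $\{r,s,k,l\}=\{1,2,3,4\}$ for $d=4$, and where, for $d=4,5$, $\gamma\in K$ is any element with $\gamma^d=\lambda_1\cdots\lambda_d$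 such that $(\sigma_1\sigma_2)^3$ acts on $V$ by the scalar $(-1)^{d+1}\gamma^6$; such a $\gamma$ exists. -/

import Mathlib

open CategoryTheory MonoidalCategory Limits Polynomial

universe w v u

noncomputable section

namespace BraidDim

section Categories

variable (K : Type w) [Field K] {C : Type u} [Category.{v} C] [Preadditive C] [Linear K C]

/-- The endomorphisms of `X` are exactly the scalars. In Turaev's terminology, `X` is simple. -/
def ScalarEnd (X : C) : Prop :=
  Function.Bijective (fun a : K => a • 𝟙 X)

variable (C) in
/-- A semisimple `K`-linear monoidal category in the sense of Turaev: the ground field is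
`End(𝟙)`, there are no nonzero morphisms between non-isomorphic objects with scalar
endomorphisms, and every object is dominated by such objects.  Direct sums and kernels are not
required to exist. An abelian `K`-linear monoidal category with finite-dimensional `Hom` spaces
and simple unit, in which every object is a finite direct sum of simple objects, is an example
when `K` is algebraically closed. -/
class SemisimpleCategory [MonoidalCategory C] : Prop where
  scalarEnd_unit : ScalarEnd K (𝟙_ C)
  hom_eq_zero : ∀ {X Y : C}, ScalarEnd K X → ScalarEnd K Y → IsEmpty (X ≅ Y) →
    ∀ f : X ⟶ Y, f = 0
  domination : ∀ X : C, ∃ (n : ℕ) (S : Fin n → C) (f : ∀ k, X ⟶ S k) (g : ∀ k, S k ⟶ X),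
    (∀ k, ScalarEnd K (S k)) ∧ ∑ k, f k ≫ g k = 𝟙 X

end Categories

section Ribbon

/-- A ribbon structure on a braided category with duals: a natural twist compatible with the
braiding and the duality. -/
class RibbonCategory (C : Type u) [Category.{v} C] [MonoidalCategory C] [BraidedCategory C]
    [RightRigidCategory C] where
  twist : ∀ X : C, X ≅ X
  twist_naturality : ∀ {X Y : C} (f : X ⟶ Y), f ≫ (twist Y).hom = (twist X).hom ≫ f
  twist_tensor : ∀ X Y : C, (twist (X ⊗ Y)).hom =
    ((twist X).hom ⊗ₘ (twist Y).hom) ≫ (β_ X Y).hom ≫ (β_ Y X).hom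
  twist_dual : ∀ X : C, (twist Xᘁ).hom = (twist X).homᘁ

variable {C : Type u} [Category.{v} C] [MonoidalCategory C] [BraidedCategory C]
  [RightRigidCategory C] [RibbonCategory C]

/-- The ribbon (quantum) trace of an endomorphism,
`ev ∘ c_{X, X*} ∘ ((θ_X ∘ f) ⊗ id) ∘ coev`. -/
def ribbonTrace {X : C} (f : X ⟶ X) : 𝟙_ C ⟶ 𝟙_ C :=
  η_ X Xᘁ ≫ (f ≫ (RibbonCategory.twist X).hom) ▷ Xᘁ ≫ (β_ X Xᘁ).hom ≫ ε_ X Xᘁ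

/-- The categorical dimension of `X`: the scalar `a` with `ribbonTrace (𝟙 X) = a • 𝟙`. -/
def catDim (K : Type w) [Field K] [Preadditive C] [Linear K C] [SemisimpleCategory K C]
    (X : C) : K :=
  (Equiv.ofBijective _ (SemisimpleCategory.scalarEnd_unit (K := K) (C := C))).symm
    (ribbonTrace (𝟙 X))

theorem catDim_smul_id (K : Type w) [Field K] [Preadditive C] [Linear K C]
    [SemisimpleCategory K C] (X : C) : catDim K X • 𝟙 (𝟙_ C) = ribbonTrace (𝟙 X) :=
  (Equiv.ofBijective _
    (SemisimpleCategory.scalarEnd_unit (K := K) (C := C))).apply_symm_apply _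

end Ribbon

section SelfDual

/-- `Z` is self-dual: the trivial object is a direct summand of `Z ⊗ Z`, of multiplicity one. -/
def IsSelfDual (K : Type w) [Field K] {C : Type u} [Category.{v} C] [Preadditive C] [Linear K C]
    [MonoidalCategory C] (Z : C) : Prop :=
  ∃ (i : 𝟙_ C ⟶ Z ⊗ Z) (p : Z ⊗ Z ⟶ 𝟙_ C),
    i ≫ p = 𝟙 _ ∧ ∀ j : 𝟙_ C ⟶ Z ⊗ Z, ∃ a : K, j = a • i

/-- `Z^{⊗ 3}`. -/
abbrev cube {C : Type u} [Category.{v} C] [MonoidalCategory C] (Z : C) : C := (Z ⊗ Z) ⊗ Z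

/-- `a ⊗ 1` on `Z^{⊗ 3}`, for `a ∈ End(Z ⊗ Z)`. -/
def actLeft {C : Type u} [Category.{v} C] [MonoidalCategory C] {Z : C} (a : Z ⊗ Z ⟶ Z ⊗ Z) :
    cube Z ⟶ cube Z :=
  a ▷ Z

/-- `1 ⊗ a` on `Z^{⊗ 3}`, for `a ∈ End(Z ⊗ Z)`. -/
def actRight {C : Type u} [Category.{v} C] [MonoidalCategory C] {Z : C} (a : Z ⊗ Z ⟶ Z ⊗ Z) :
    cube Z ⟶ cube Z :=
  (α_ Z Z Z).hom ≫ Z ◁ a ≫ (α_ Z Z Z).inv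

/-- The projection of `X` onto the `i`-th summand in a direct sum decomposition. -/
def summandProj {C : Type u} [Category.{v} C] [Preadditive C] {ι : Type} {X : C} {Y : ι → C}
    [HasBiproduct Y] (e : X ≅ ⨁ Y) (i : ι) : X ⟶ X :=
  (e.hom ≫ biproduct.π Y i) ≫ biproduct.ι Y i ≫ e.inv

end SelfDual

section Braid

/-- The braid relation `σ₁σ₂σ₁ = σ₂σ₁σ₂`. -/
def braidRels : Set (FreeGroup (Fin 2)) :=
  {FreeGroup.of 0 * FreeGroup.of 1 * FreeGroup.of 0 *
    (FreeGroup.of 1 * FreeGroup.of 0 * FreeGroup.of 1)⁻¹}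

/-- Artin's braid group on three strands. -/
abbrev B3 : Type := PresentedGroup braidRels

/-- The generators `σ₁` (index `0`) and `σ₂` (index `1`). -/
def braidGen (j : Fin 2) : B3 := PresentedGroup.of j

variable {C : Type u} [Category.{v} C] [MonoidalCategory C] [BraidedCategory C]

/-- The automorphisms `c₁ = c ⊗ 1` and `c₂ = 1 ⊗ c` of `Z^{⊗ 3}`, with `c` the braiding. -/
def braidAut (Z : C) : Fin 2 → Aut (cube Z) :=
  ![whiskerRightIso (β_ Z Z) Z,
    α_ Z Z Z ≪≫ whiskerLeftIso Z (β_ Z Z) ≪≫ (α_ Z Z Z).symm]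

theorem braidAut_zero_hom (Z : C) : (braidAut Z 0).hom = actLeft (β_ Z Z).hom := rfl

theorem braidAut_one_hom (Z : C) : (braidAut Z 1).hom = actRight (β_ Z Z).hom := rfl

theorem braidAut_rel (Z : C) :
    braidAut Z 0 * braidAut Z 1 * braidAut Z 0 = braidAut Z 1 * braidAut Z 0 * braidAut Z 1 := by
  apply Iso.ext
  have h := BraidedCategory.yang_baxter Z Z Z
  rw [Iso.inv_comp_eq] at h
  change actLeft (β_ Z Z).hom ≫ actRight (β_ Z Z).hom ≫ actLeft (β_ Z Z).hom =
    actRight (β_ Z Z).hom ≫ actLeft (β_ Z Z).hom ≫ actRight (β_ Z Z).hom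
  simp only [actLeft, actRight, Category.assoc]
  rw [← cancel_mono (α_ Z Z Z).hom]
  simp only [Category.assoc, Iso.inv_hom_id, Category.comp_id]
  exact h

/-- The action of `B₃` on `Z^{⊗ 3}`. -/
def braidHom (Z : C) : B3 →* Aut (cube Z) :=
  PresentedGroup.toGroup (f := braidAut Z) (by
    rintro r rfl
    simpa only [map_mul, map_inv, FreeGroup.lift_apply_of, mul_inv_eq_one] using braidAut_rel Z)

variable (K : Type w) [Field K] [Preadditive C] [Linear K C]

/-- The `B₃`-module `Hom(Z, Z^{⊗ 3})`, on which `σ_j` acts by `f ↦ c_j ∘ f`. -/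
def braidRep (Z : C) : Representation K B3 (Z ⟶ cube Z) where
  toFun b := Linear.rightComp K Z (braidHom Z b).hom
  map_one' := by
    ext f
    rw [map_one]
    exact Category.comp_id f
  map_mul' a b := by
    ext f
    rw [map_mul]
    exact (Category.assoc f _ _).symm

theorem braidRep_braidGen_apply (Z : C) (j : Fin 2) (f : Z ⟶ cube Z) :
    braidRep K Z (braidGen j) f = f ≫ (braidAut Z j).hom := by
  simp [braidRep, braidGen, braidHom]

end Braid

section Polynomials

variable {K : Type w} [Field K] {d : ℕ}

/-- `P_r^{(d)}(x) = ∏_{i ≠ r} (x - λ_i)`. -/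
def polyP (lam : Fin d → K) (r : Fin d) : K[X] :=
  ∏ i ∈ Finset.univ.erase r, (X - C (lam i))

/-- `Q_{rs}^{(2)}`, with `a = λ_r`, `b = λ_s`. -/
def polyQ2 (a b : K) : K := -a ^ 2 + a * b - b ^ 2

/-- `Q_{rs}^{(3)}`, with `a = λ_r`, `b = λ_s` and `k` the remaining eigenvalue. -/
def polyQ3 (a b k : K) : K := (a ^ 2 + b * k) * (b ^ 2 + a * k)

/-- `Q_{rs}^{(4)}`, with `a = λ_r`, `b = λ_s` and `k`, `l` the remaining eigenvalues. -/
def polyQ4 (γ a b k l : K) : K :=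
  -(γ ^ 2)⁻¹ * (a ^ 2 + γ ^ 2) * (b ^ 2 + γ ^ 2) *
    (γ ^ 2 + a * k + b * l) * (γ ^ 2 + a * l + b * k)

/-- `Q_{rs}^{(5)}`, with `a = λ_r`, `b = λ_s` and `k`, `l`, `m` the remaining eigenvalues. -/
def polyQ5 (γ a b k l m : K) : K :=
  (γ ^ 8)⁻¹ * (γ ^ 2 + a * γ + a ^ 2) * (γ ^ 2 + b * γ + b ^ 2) *
    (((γ ^ 2 + a * k) * (γ ^ 2 + b * k)) * ((γ ^ 2 + a * l) * (γ ^ 2 + b * l)) *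
      ((γ ^ 2 + a * m) * (γ ^ 2 + b * m)))

/-- `γ` is a `d`-th root of `det(σ₁) = ∏ λ_i` on the representation `ρ`, chosen such that
`(σ₁σ₂σ₁)² = (σ₁σ₂)³` acts by `(-1)^{d+1} γ⁶`. -/
def IsGamma {V : Type v} [AddCommGroup V] [Module K V] (ρ : Representation K B3 V)
    (lam : Fin d → K) (γ : K) : Prop :=
  γ ^ d = ∏ i, lam i ∧
    ρ ((braidGen 0 * braidGen 1 * braidGen 0) ^ 2) = ((-1) ^ (d + 1) * γ ^ 6) • (1 : V →ₗ[K] V)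

/-- `Q` is the family `Q_{rs}^{(d)}` for the representation `ρ`, on which `σ₁` has the
eigenvalues `λ_i`: with `A = ρ(σ₁)` and `B = ρ(σ₂)`, the scalar `Q_{rs}` is the unique one
with `P_r(A) P_s(B) P_r(A) = Q_{rs} P_r(A)`; for `2 ≤ d ≤ 5` and `r ≠ s` it is the value of
an explicit Laurent polynomial in the `λ_i` and, for `d = 4, 5`, in `γ`. -/
structure IsQFamily {V : Type v} [AddCommGroup V] [Module K V] (ρ : Representation K B3 V)
    (lam : Fin d → K) (Q : Fin d → Fin d → K) : Prop where
  relation : ∀ (r s : Fin d) (q : K),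
    aeval (ρ (braidGen 0)) (polyP lam r) * aeval (ρ (braidGen 1)) (polyP lam s) *
      aeval (ρ (braidGen 0)) (polyP lam r) = q • aeval (ρ (braidGen 0)) (polyP lam r) ↔ q = Q r s
  two : d = 2 → ∀ r s : Fin d, r ≠ s → Q r s = polyQ2 (lam r) (lam s)
  three : d = 3 → ∀ r s k : Fin d, [r, s, k].Nodup →
    Q r s = polyQ3 (lam r) (lam s) (lam k)
  four : d = 4 → (∃ γ, IsGamma ρ lam γ) ∧ ∀ γ, IsGamma ρ lam γ →
    ∀ r s k l : Fin d, [r, s, k, l].Nodup →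
      Q r s = polyQ4 γ (lam r) (lam s) (lam k) (lam l)
  five : d = 5 → (∃ γ, IsGamma ρ lam γ) ∧ ∀ γ, IsGamma ρ lam γ →
    ∀ r s k l m : Fin d, [r, s, k, l, m].Nodup →
      Q r s = polyQ5 γ (lam r) (lam s) (lam k) (lam l) (lam m)

end Polynomials

end BraidDim

end

open BraidDim

/-! A nonzero map from the unit to `Z ⊗ Z` makes `Z` its own dual, so bending one strand identifies
`V = Hom(Z, Z^{⊗3})` with `End(Z ⊗ Z)`. The latter has the projections onto the `Y_i` as a basis,
and this becomes an eigenbasis of `σ₁` with the distinct eigenvalues `λ_i`.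

Let `o` be an index with `Y_o ≅ 𝟙_ C`. The projection onto `Y_o` is a multiple of coevaluation after
evaluation, so compressing `p^{(i)} ⊗ 1` by `1 ⊗ p^{(o)}` closes one strand of `p^{(i)}`: it yields
a partial trace, which is a scalar because `Z` is simple. Comparison with the ribbon trace
(`exists_catDim_eq`) shows this scalar to be `dim Y_i / (dim Z)²`. The choice of duality costs at
most a sign in `dim Z`, invisible in the square. This proves (2). Since `p^{(i)}` acts as `P_i(A) /
P_i(λ_i)`, it also yields the dimension formula, once `σ₁` and `σ₂` are exchanged by conjugation
with the half twist `Δ = σ₁σ₂σ₁`.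

The rest is linear algebra. Let `T` be the matrix of `Δ` in the eigenbasis and `D = diag(λ_i)`. The
scalar of `P_r(A) P_s(B) P_r(A)` is `P_r(λ_r) P_s(λ_s) T_rs (T⁻¹)_sr`. Because all `dim Y_i` are
nonzero, row and column `o` of `T` have no zero entry. This gives irreducibility and makes `Δ²` a
scalar `z`, so `T² = z` and `T D⁻¹ T = D T D`, whence the required products are `T_rs T_sr`.

For `d ≤ 4`, a combination `f` of `1, x⁻¹, x` can vanish at all but two eigenvalues. Entries of `T
f(D) T` then give the sums `Σ T_kk λ_k^j`, hence `T_rr` by interpolation, hence `T_rs T_sr`. For `d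
= 4`, `trace T = 0` and `det T = (∏ λ_i)³` produce `γ`. For `d = 5` this is not enough. There `T`
and `U = T D⁻¹`, a square root and a cube root of `z`, have no common eigenvector, which bounds the
dimensions of their eigenspaces. It follows that `U² + uU + u²` has rank at most one for a suitable
cube root `u` of `z`, and this relates `T_rs T_sr` to diagonal entries (`exists_spectral_five`). -/

noncomputable section

namespace BraidDim

/-! ### Matrix identities for the half twist -/

section BraidMatrices

variable {K : Type w} [Field K] {d : ℕ}

/-- The matrix `T` of `σ₁σ₂σ₁` in a basis of eigenvectors of `σ₁` with eigenvalues `λ_i`, when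
`(σ₁σ₂)³` acts by the scalar `z`. -/
structure IsBraidMatrix (T : Matrix (Fin d) (Fin d) K) (lam : Fin d → K) (z : K) : Prop where
  ne_zero : ∀ i, lam i ≠ 0
  injective : Function.Injective lam
  scalar_ne_zero : z ≠ 0
  sq : T * T = z • 1
  rel : T * Matrix.diagonal lam⁻¹ * T = Matrix.diagonal lam * T * Matrix.diagonal lam

namespace IsBraidMatrix

variable {T : Matrix (Fin d) (Fin d) K} {lam : Fin d → K} {z : K}

theorem diagonal_mul_inv (h : IsBraidMatrix T lam z) :
    Matrix.diagonal lam * Matrix.diagonal lam⁻¹ = 1 := by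
  rw [Matrix.diagonal_mul_diagonal, ← Matrix.diagonal_one]
  congr 1
  funext i
  exact mul_inv_cancel₀ (h.ne_zero i)

theorem inv_mul_diagonal (h : IsBraidMatrix T lam z) :
    Matrix.diagonal lam⁻¹ * Matrix.diagonal lam = 1 := by
  rw [Matrix.diagonal_mul_diagonal, ← Matrix.diagonal_one]
  congr 1
  funext i
  exact inv_mul_cancel₀ (h.ne_zero i)

theorem rel_inv (h : IsBraidMatrix T lam z) :
    T * Matrix.diagonal lam * T =
      z • (Matrix.diagonal lam⁻¹ * T * Matrix.diagonal lam⁻¹) := by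
  have h1 : Matrix.diagonal lam * (T * Matrix.diagonal lam * T) =
      z • (T * Matrix.diagonal lam⁻¹) := by
    rw [← mul_assoc, ← mul_assoc, ← h.rel, mul_assoc _ T T, h.sq, mul_smul_comm, mul_one]
  calc _ = Matrix.diagonal lam⁻¹ * (Matrix.diagonal lam * (T * Matrix.diagonal lam * T)) := by
        rw [← mul_assoc, h.inv_mul_diagonal, one_mul]
    _ = _ := by rw [h1, mul_smul_comm, mul_assoc]

/-- These are the entries of `T (α + β D⁻¹ + κ D) T`, each term of which is known from `sq`, `rel`
and `rel_inv`. -/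
theorem sum_mul_mul (h : IsBraidMatrix T lam z) (α β κ : K) (r s : Fin d) :
    ∑ k, T r k * T k s * (α + β * (lam k)⁻¹ + κ * lam k) =
      (if r = s then α * z else 0) +
        (β * (lam r * lam s) + κ * z * (lam r * lam s)⁻¹) * T r s := by
  have h1 := congrFun (congrFun h.sq r) s
  have h2 := congrFun (congrFun h.rel r) s
  have h3 := congrFun (congrFun h.rel_inv r) s
  rw [Matrix.mul_diagonal, Matrix.diagonal_mul, Matrix.mul_apply] at h2
  rw [Matrix.smul_apply, Matrix.mul_diagonal, Matrix.diagonal_mul, Matrix.mul_apply] at h3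
  rw [Matrix.mul_apply, Matrix.smul_apply, Matrix.one_apply] at h1
  simp only [Matrix.mul_diagonal, Pi.inv_apply, smul_eq_mul] at h1 h2 h3
  have e : ∀ k, T r k * T k s * (α + β * (lam k)⁻¹ + κ * lam k) =
      α * (T r k * T k s) + β * (T r k * (lam k)⁻¹ * T k s) + κ * (T r k * lam k * T k s) :=
    fun k => by ring
  simp_rw [e, Finset.sum_add_distrib, ← Finset.mul_sum, h1, h2, h3]
  rw [mul_inv]
  split_ifs <;> ring

/-- The trace of `T D T` is `z` times that of `D`, by cyclicity and `T² = z`. The companion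
`sum_diag_sq` treats `T D⁻¹ T` likewise. -/
theorem sum_diag_inv_sq (h : IsBraidMatrix T lam z) :
    ∑ k, T k k * ((lam k)⁻¹ * (lam k)⁻¹) = ∑ k, lam k := by
  have h1 := congrArg Matrix.trace h.rel_inv
  rw [Matrix.trace_mul_cycle, h.sq, Matrix.trace_smul, smul_mul_assoc, one_mul,
    Matrix.trace_smul] at h1
  have h2 := smul_right_injective K h.scalar_ne_zero h1
  rw [Matrix.trace_diagonal] at h2
  rw [h2, Matrix.trace]
  refine Finset.sum_congr rfl fun k _ => ?_
  rw [Matrix.diag_apply, Matrix.mul_diagonal, Matrix.diagonal_mul, Pi.inv_apply]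
  ring

theorem sum_diag_sq (h : IsBraidMatrix T lam z) :
    ∑ k, T k k * (lam k * lam k) = z * ∑ k, (lam k)⁻¹ := by
  have h1 := congrArg Matrix.trace h.rel
  rw [Matrix.trace_mul_cycle, h.sq, smul_mul_assoc, one_mul,
    Matrix.trace_smul, Matrix.trace_diagonal, Matrix.trace, smul_eq_mul] at h1
  simp only [Pi.inv_apply] at h1
  rw [h1]
  refine Finset.sum_congr rfl fun k _ => ?_
  rw [Matrix.diag_apply, Matrix.mul_diagonal, Matrix.diagonal_mul]
  ring

/-- If `f(λ_k)` vanishes off `{r, s}`, the `(r, s)` entry of `T f(D) T` is `T_rs` times the weighted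
trace of `T`. Cancelling `T_rs` turns a quadratic relation into a linear one on the diagonal
entries. -/
theorem sum_diag_mul (h : IsBraidMatrix T lam z) {α β κ : K} {r s : Fin d} (hrs : r ≠ s)
    (hT : T r s ≠ 0) (hf : ∀ k, k ≠ r → k ≠ s → α + β * (lam k)⁻¹ + κ * lam k = 0) :
    ∑ k, T k k * (α + β * (lam k)⁻¹ + κ * lam k) =
      β * (lam r * lam s) + κ * z * (lam r * lam s)⁻¹ := by
  have h1 := h.sum_mul_mul α β κ r s
  rw [if_neg hrs, zero_add] at h1
  have key : ∀ g : Fin d → K,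
      ∑ k, g k * (α + β * (lam k)⁻¹ + κ * lam k) =
        g r * (α + β * (lam r)⁻¹ + κ * lam r) + g s * (α + β * (lam s)⁻¹ + κ * lam s) := by
    intro g
    rw [← Finset.sum_pair (f := fun k => g k * (α + β * (lam k)⁻¹ + κ * lam k)) hrs]
    symm
    apply Finset.sum_subset (Finset.subset_univ _)
    intro k _ hk
    simp only [Finset.mem_insert, Finset.mem_singleton, not_or] at hk
    rw [hf k hk.1 hk.2, mul_zero]
  rw [key] at h1 ⊢
  apply mul_right_cancel₀ hT
  rw [← h1]
  ring

end IsBraidMatrix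

theorem toFinset_eq_univ {l : List (Fin d)} (hl : l.Nodup) (hd : l.length = d) :
    l.toFinset = Finset.univ := by
  apply Finset.eq_univ_of_card
  rw [List.toFinset_card_of_nodup hl, Fintype.card_fin, hd]

theorem mem_of_nodup_of_length_eq {l : List (Fin d)} (hl : l.Nodup) (hd : l.length = d)
    (i : Fin d) : i ∈ l := by
  rw [← List.mem_toFinset, toFinset_eq_univ hl hd]
  exact Finset.mem_univ i

theorem sum_univ_eq_list_sum {l : List (Fin d)} (hl : l.Nodup) (hd : l.length = d)
    (f : Fin d → K) : ∑ i, f i = (l.map f).sum := by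
  rw [← List.sum_toFinset f hl, toFinset_eq_univ hl hd]

theorem prod_univ_eq_list_prod {l : List (Fin d)} (hl : l.Nodup) (hd : l.length = d)
    (f : Fin d → K) : ∏ i, f i = (l.map f).prod := by
  rw [← List.prod_toFinset f hl, toFinset_eq_univ hl hd]

theorem eval_polyP_self (lam : Fin d → K) (r : Fin d) :
    (polyP lam r).eval (lam r) = ∏ i ∈ Finset.univ.erase r, (lam r - lam i) := by
  simp [polyP, eval_prod]

theorem eval_polyP_of_ne (lam : Fin d → K) {r i : Fin d} (h : i ≠ r) :
    (polyP lam r).eval (lam i) = 0 := by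
  rw [polyP, eval_prod]
  exact Finset.prod_eq_zero (Finset.mem_erase.2 ⟨h, Finset.mem_univ i⟩) (by simp)

theorem eval_polyP_self_ne_zero {lam : Fin d → K} (h : Function.Injective lam) (r : Fin d) :
    (polyP lam r).eval (lam r) ≠ 0 := by
  rw [eval_polyP_self, Finset.prod_ne_zero_iff]
  intro i hi
  rw [Finset.mem_erase] at hi
  exact sub_ne_zero.2 fun e => hi.1 (h e).symm

theorem eval_polyP_eq_list_prod (lam : Fin d → K) {r : Fin d} {l : List (Fin d)}
    (hl : (r :: l).Nodup) (hd : (r :: l).length = d) :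
    (polyP lam r).eval (lam r) = (l.map fun i => lam r - lam i).prod := by
  rw [eval_polyP_self, ← List.prod_toFinset _ (List.nodup_cons.1 hl).2,
    ← toFinset_eq_univ hl hd, List.toFinset_cons, Finset.erase_insert]
  rw [List.mem_toFinset]
  exact (List.nodup_cons.1 hl).1

end BraidMatrices

/-! ### The products `T_rs T_sr` in dimensions two, three and four -/

section LowDimension

variable {K : Type w} [Field K] {z : K}

namespace IsBraidMatrix

theorem diag_two {T : Matrix (Fin 2) (Fin 2) K} {lam : Fin 2 → K} (h : IsBraidMatrix T lam z)
    {o : Fin 2} (hT : ∀ s, s ≠ o → T o s ≠ 0) :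
    ∑ k, T k k = 0 ∧ ∑ k, T k k * (lam k)⁻¹ = ∏ i, lam i := by
  obtain ⟨s, hs⟩ : ∃ s, [o, s].Nodup := by
    clear hT
    revert o
    decide
  have hs' : o ≠ s := by simpa using hs
  have hmem : ∀ k, k ≠ o → k ≠ s → False := fun k h1 h2 => by
    simpa [h1, h2] using mem_of_nodup_of_length_eq hs rfl k
  have h0 := h.sum_diag_mul (α := 1) (β := 0) (κ := 0) hs' (hT s hs'.symm)
    fun k h1 h2 => (hmem k h1 h2).elim
  have h1 := h.sum_diag_mul (α := 0) (β := 1) (κ := 0) hs' (hT s hs'.symm)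
    fun k h1 h2 => (hmem k h1 h2).elim
  rw [prod_univ_eq_list_prod hs rfl]
  simpa using And.intro h0 h1

theorem apply_mul_apply_two {T : Matrix (Fin 2) (Fin 2) K} {lam : Fin 2 → K}
    (h : IsBraidMatrix T lam z) {o : Fin 2} (hT : ∀ s, s ≠ o → T o s ≠ 0) {r s : Fin 2}
    (hrs : r ≠ s) :
    (polyP lam r).eval (lam r) * (polyP lam s).eval (lam s) * (T r s * T s r) =
      polyQ2 (lam r) (lam s) * z := by
  have hl : [r, s].Nodup := by simpa using hrs
  have hl' : [s, r].Nodup := by simpa using hrs.symm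
  obtain ⟨t0, t1⟩ := h.diag_two hT
  have d1 := h.sum_mul_mul 1 0 0 r r
  have d2 := h.sum_mul_mul 0 1 0 r r
  rw [eval_polyP_eq_list_prod lam hl rfl, eval_polyP_eq_list_prod lam hl' rfl]
  rw [sum_univ_eq_list_sum hl rfl] at t0 t1 d1 d2
  rw [prod_univ_eq_list_prod hl rfl] at t1
  have ha := h.ne_zero r
  have hb := h.ne_zero s
  have hab : lam r - lam s ≠ 0 := sub_ne_zero.2 (h.injective.ne hrs)
  simp only [List.map_cons, List.map_nil, List.sum_cons, List.sum_nil, List.prod_cons,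
    List.prod_nil, add_zero, mul_one, zero_mul, zero_add, one_mul, if_true] at *
  generalize T r r = x at *
  generalize T s s = y at *
  generalize T r s * T s r = p at *
  generalize lam r = a at *
  generalize lam s = b at *
  obtain rfl : y = -x := by linear_combination t0
  have hx : x = -(a ^ 2 * b ^ 2) / (a - b) := by
    field_simp at t1 ⊢
    linear_combination -t1
  have hp : p = b * (a ^ 2 * x - x ^ 2 / a) := by
    field_simp at d2 ⊢
    linear_combination d2
  rw [← d1, hp, hx, polyQ2]
  field_simp
  ring

theorem diag_three {T : Matrix (Fin 3) (Fin 3) K} {lam : Fin 3 → K} (h : IsBraidMatrix T lam z)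
    {o : Fin 3} (hT : ∀ s, s ≠ o → T o s ≠ 0) :
    ∑ k, T k k = -∏ i, lam i ∧ ∑ k, T k k * (lam k)⁻¹ = 0 ∧ ∑ k, T k k * lam k = 0 ∧
      z = (∏ i, lam i) ^ 2 := by
  obtain ⟨s, k, hl⟩ : ∃ s k, [o, s, k].Nodup := by
    clear hT
    revert o
    decide
  -- The weights `λ⁻¹ - λ_k⁻¹` and `λ - λ_k` both vanish at the one remaining eigenvalue.
  have key : ∀ s k, [o, s, k].Nodup →
      ∑ k, T k k * (lam k)⁻¹ - (lam k)⁻¹ * ∑ k, T k k = lam o * lam s ∧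
      ∑ k, T k k * lam k - lam k * ∑ k, T k k = z * (lam o * lam s)⁻¹ := by
    intro s k hl
    have hs : o ≠ s := by
      rintro rfl; simp at hl
    have hmem : ∀ i, i ≠ o → i ≠ s → i = k := fun i h1 h2 => by
      simpa [h1, h2] using mem_of_nodup_of_length_eq hl rfl i
    have h0 := h.sum_diag_mul (α := -(lam k)⁻¹) (β := 1) (κ := 0) hs (hT s hs.symm)
      fun i h1 h2 => by rw [hmem i h1 h2]; ring
    have h1 := h.sum_diag_mul (α := -(lam k)) (β := 0) (κ := 1) hs (hT s hs.symm)
      fun i h1 h2 => by rw [hmem i h1 h2]; ring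
    rw [Finset.mul_sum, Finset.mul_sum, ← Finset.sum_sub_distrib, ← Finset.sum_sub_distrib]
    constructor
    · rw [one_mul, zero_mul, zero_mul, add_zero] at h0
      rw [← h0]
      exact Finset.sum_congr rfl fun i _ => by ring
    · rw [zero_mul, zero_add, one_mul] at h1
      rw [← h1]
      exact Finset.sum_congr rfl fun i _ => by ring
  have hl' : [o, k, s].Nodup := by
    simp only [List.nodup_cons, List.mem_cons, List.not_mem_nil] at hl ⊢
    tauto
  obtain ⟨e1, e2⟩ := key s k hl
  obtain ⟨e3, e4⟩ := key k s hl'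
  rw [prod_univ_eq_list_prod hl rfl]
  have ha := h.ne_zero o
  have hb := h.ne_zero s
  have hc := h.ne_zero k
  have hbc : lam s - lam k ≠ 0 := sub_ne_zero.2 (h.injective.ne (by
    rintro rfl; simp at hl))
  simp only [List.map_cons, List.map_nil, List.prod_cons, List.prod_nil, mul_one]
  generalize ∑ k, T k k = s0 at *
  generalize ∑ k, T k k * (lam k)⁻¹ = s1 at *
  generalize ∑ k, T k k * lam k = s2 at *
  generalize lam o = a at *
  generalize lam s = b at *
  generalize lam k = c at *
  have h1 : s1 = 0 := by
    apply mul_left_cancel₀ hbc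
    field_simp at e1 e3
    linear_combination e3 - e1
  have h0 : s0 = -(a * (b * c)) := by
    rw [h1] at e1
    field_simp at e1
    linear_combination -e1
  have hz : z = (a * (b * c)) ^ 2 := by
    apply mul_left_cancel₀ hbc
    rw [h0] at e2 e4
    field_simp at e2 e4
    linear_combination c * e2 - b * e4
  refine ⟨h0, h1, ?_, hz⟩
  rw [h0, hz] at e2
  field_simp at e2
  linear_combination e2

theorem apply_mul_apply_three {T : Matrix (Fin 3) (Fin 3) K} {lam : Fin 3 → K}
    (h : IsBraidMatrix T lam z) {o : Fin 3} (hT : ∀ s, s ≠ o → T o s ≠ 0) {r s k : Fin 3}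
    (hl : [r, s, k].Nodup) :
    (polyP lam r).eval (lam r) * (polyP lam s).eval (lam s) * (T r s * T s r) =
      polyQ3 (lam r) (lam s) (lam k) * z := by
  have hl' : [s, r, k].Nodup := by
    simp only [List.nodup_cons, List.mem_cons, List.not_mem_nil] at hl ⊢
    tauto
  obtain ⟨t0, t1, t2, hz⟩ := h.diag_three hT
  -- The weight `λ - λ_k` removes the `k` term, so this diagonal entry involves only `T_rr²` and
  -- `T_rs T_sr`.
  have d1 := h.sum_mul_mul (-lam k) 0 1 r r
  rw [eval_polyP_eq_list_prod lam hl rfl, eval_polyP_eq_list_prod lam hl' rfl]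
  rw [sum_univ_eq_list_sum hl rfl] at t0 t1 t2 d1
  rw [prod_univ_eq_list_prod hl rfl] at hz t0
  have ha := h.ne_zero r
  have hb := h.ne_zero s
  have hc := h.ne_zero k
  have hab : lam r - lam s ≠ 0 := sub_ne_zero.2 (h.injective.ne (by rintro rfl; simp at hl))
  have hac : lam r - lam k ≠ 0 := sub_ne_zero.2 (h.injective.ne (by rintro rfl; simp at hl))
  have hbc : lam s - lam k ≠ 0 := sub_ne_zero.2 (h.injective.ne (by rintro rfl; simp at hl))
  simp only [List.map_cons, List.map_nil, List.sum_cons, List.sum_nil, List.prod_cons,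
    List.prod_nil, add_zero, mul_one, zero_mul, zero_add, one_mul, if_true] at *
  generalize T r r = x at *
  generalize T s s = y at *
  generalize T k k = v at *
  generalize T r s * T s r = p at *
  generalize lam r = a at *
  generalize lam s = b at *
  generalize lam k = c at *
  -- Lagrange interpolation: the three weighted traces determine each diagonal entry.
  have hx : x = a ^ 2 * b * c * (b + c) / ((a - b) * (a - c)) := by
    field_simp at t1 ⊢
    linear_combination a * t2 - a * (b + c) * t0 + t1
  have hp : p = (-c * z + z * x / (a * a) - x ^ 2 * (a - c)) / (b - c) := by
    field_simp at d1 ⊢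
    linear_combination d1
  rw [hp, hx, hz, polyQ3]
  field_simp
  ring

/-- The weight `(λ - λ_k)(λ - λ_l)/λ` vanishes at two eigenvalues. The three choices of the partner
`s` of `o` give three linear equations for three weighted traces. -/
theorem diag_four {T : Matrix (Fin 4) (Fin 4) K} {lam : Fin 4 → K} (h : IsBraidMatrix T lam z)
    {o : Fin 4} (hT : ∀ s, s ≠ o → T o s ≠ 0) :
    ∑ k, T k k = 0 ∧ ∑ k, T k k * (lam k)⁻¹ = z / ∏ i, lam i ∧
      ∑ k, T k k * lam k = ∏ i, lam i := by
  obtain ⟨s, k, l, hl⟩ : ∃ s k l, [o, s, k, l].Nodup := by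
    clear hT
    revert o
    decide
  have key : ∀ s k l, [o, s, k, l].Nodup →
      ∑ i, T i i * lam i - (lam k + lam l) * ∑ i, T i i +
        lam k * lam l * ∑ i, T i i * (lam i)⁻¹ =
        lam k * lam l * (lam o * lam s) + z * (lam o * lam s)⁻¹ := by
    intro s k l hl
    have hs : o ≠ s := by
      rintro rfl; simp at hl
    have hmem : ∀ i, i ≠ o → i ≠ s → i = k ∨ i = l := fun i h1 h2 => by
      simpa [h1, h2] using mem_of_nodup_of_length_eq hl rfl i
    have hk := h.ne_zero k
    have hl0 := h.ne_zero l
    have h0 := h.sum_diag_mul (α := -(lam k + lam l)) (β := lam k * lam l) (κ := 1) hs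
      (hT s hs.symm) fun i h1 h2 => by
        rcases hmem i h1 h2 with rfl | rfl <;> field_simp <;> ring
    rw [one_mul] at h0
    rw [Finset.mul_sum, Finset.mul_sum, ← Finset.sum_sub_distrib, ← Finset.sum_add_distrib, ← h0]
    exact Finset.sum_congr rfl fun i _ => by ring
  have e1 := key s k l hl
  have e2 := key k s l (by
    simp only [List.nodup_cons, List.mem_cons, List.not_mem_nil] at hl ⊢
    tauto)
  have e3 := key l s k (by
    simp only [List.nodup_cons, List.mem_cons, List.not_mem_nil] at hl ⊢
    tauto)
  rw [prod_univ_eq_list_prod hl rfl]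
  have ha := h.ne_zero o
  have hb := h.ne_zero s
  have hc := h.ne_zero k
  have he := h.ne_zero l
  have hbc : lam s - lam k ≠ 0 := sub_ne_zero.2 (h.injective.ne (by rintro rfl; simp at hl))
  have hbe : lam s - lam l ≠ 0 := sub_ne_zero.2 (h.injective.ne (by rintro rfl; simp at hl))
  have hce : lam k - lam l ≠ 0 := sub_ne_zero.2 (h.injective.ne (by rintro rfl; simp at hl))
  simp only [List.map_cons, List.map_nil, List.prod_cons, List.prod_nil, mul_one]
  generalize ∑ k, T k k = s0 at *
  generalize ∑ k, T k k * (lam k)⁻¹ = s1 at *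
  generalize ∑ k, T k k * lam k = s2 at *
  generalize lam o = a at *
  generalize lam s = b at *
  generalize lam k = c at *
  generalize lam l = e at *
  obtain ⟨q, hq⟩ : ∃ q, z = q * (a * b * c * e) :=
    ⟨z / (a * b * c * e), by field_simp⟩
  have hq1 : z * (a * b)⁻¹ = q * c * e := by rw [hq]; field_simp
  have hq2 : z * (a * c)⁻¹ = q * b * e := by rw [hq]; field_simp
  have hq3 : z * (a * e)⁻¹ = q * b * c := by rw [hq]; field_simp
  rw [hq1] at e1
  rw [hq2] at e2
  rw [hq3] at e3
  have f1 : -s0 + e * s1 - e * q = 0 := by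
    apply mul_left_cancel₀ hbc
    linear_combination e2 - e1
  have f2 : -s0 + c * s1 - c * q = 0 := by
    apply mul_left_cancel₀ hbe
    linear_combination e3 - e1
  have h1 : s1 = q := by
    apply mul_left_cancel₀ hce
    linear_combination f2 - f1
  have h0 : s0 = 0 := by
    rw [h1] at f1
    linear_combination -f1
  refine ⟨h0, ?_, ?_⟩
  · rw [h1, hq]
    field_simp
  · rw [h0, h1] at e1
    linear_combination e1

theorem apply_mul_apply_four {T : Matrix (Fin 4) (Fin 4) K} {lam : Fin 4 → K}
    (h : IsBraidMatrix T lam z) {o : Fin 4} (hT : ∀ s, s ≠ o → T o s ≠ 0) {γ : K}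
    (hγ : γ ^ 4 = ∏ i, lam i) (hz : z = -γ ^ 6) {r s k l : Fin 4} (hl : [r, s, k, l].Nodup) :
    (polyP lam r).eval (lam r) * (polyP lam s).eval (lam s) * (T r s * T s r) =
      polyQ4 γ (lam r) (lam s) (lam k) (lam l) * z := by
  have hl' : [s, r, k, l].Nodup := by
    simp only [List.nodup_cons, List.mem_cons, List.not_mem_nil] at hl ⊢
    tauto
  obtain ⟨t0, t1, t2⟩ := h.diag_four hT
  have t3 := h.sum_diag_inv_sq
  have d1 := h.sum_mul_mul (-(lam k + lam l)) (lam k * lam l) 1 r r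
  rw [eval_polyP_eq_list_prod lam hl rfl, eval_polyP_eq_list_prod lam hl' rfl]
  rw [← hγ] at t1 t2
  rw [sum_univ_eq_list_sum hl rfl] at t0 t1 t2 d1
  rw [sum_univ_eq_list_sum hl rfl, sum_univ_eq_list_sum hl rfl] at t3
  rw [prod_univ_eq_list_prod hl rfl] at hγ
  have hz0 := h.scalar_ne_zero
  have ha := h.ne_zero r
  have hb := h.ne_zero s
  have hc := h.ne_zero k
  have he := h.ne_zero l
  have hab : lam r - lam s ≠ 0 := sub_ne_zero.2 (h.injective.ne (by rintro rfl; simp at hl))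
  have hac : lam r - lam k ≠ 0 := sub_ne_zero.2 (h.injective.ne (by rintro rfl; simp at hl))
  have hae : lam r - lam l ≠ 0 := sub_ne_zero.2 (h.injective.ne (by rintro rfl; simp at hl))
  have hbc : lam s - lam k ≠ 0 := sub_ne_zero.2 (h.injective.ne (by rintro rfl; simp at hl))
  have hbe : lam s - lam l ≠ 0 := sub_ne_zero.2 (h.injective.ne (by rintro rfl; simp at hl))
  simp only [List.map_cons, List.map_nil, List.sum_cons, List.sum_nil, List.prod_cons,
    List.prod_nil, add_zero, mul_one, one_mul, if_true] at *
  generalize T r r = x at *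
  generalize T s s = y at *
  generalize T k k = v at *
  generalize T l l = v' at *
  generalize T r s * T s r = p at *
  generalize lam r = a at *
  generalize lam s = b at *
  generalize lam k = c at *
  generalize lam l = e at *
  have hγ0 : γ ≠ 0 := by
    rintro rfl
    apply hz0
    rw [hz]
    ring
  obtain ⟨g, hg⟩ : ∃ g, g = γ ^ 2 := ⟨_, rfl⟩
  have hg0 : g ≠ 0 := by rw [hg]; exact pow_ne_zero 2 hγ0
  have hz' : z = -g ^ 3 := by rw [hz, hg]; ring
  have hγ4 : γ ^ 4 = g ^ 2 := by rw [hg]; ring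
  rw [hγ4] at hγ t1 t2
  rw [polyQ4, ← hg]
  have hx1 : x * ((a - b) * (a - c) * (a - e)) =
      -(a ^ 2 * ((b * c + b * e + c * e) * g + b * c * e * (b + (c + e)))) := by
    -- With `T_kk = λ_k² x_k` the four known traces become the moments of `x` of orders `0` to `3`.
    -- Pairing them with the coefficients of `(X - b)(X - c)(X - e)` isolates the entry at `a`.
    obtain ⟨x, rfl⟩ : ∃ x', x = a ^ 2 * x' := ⟨x / a ^ 2, by field_simp⟩
    obtain ⟨y, rfl⟩ : ∃ x', y = b ^ 2 * x' := ⟨y / b ^ 2, by field_simp⟩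
    obtain ⟨v, rfl⟩ : ∃ x', v = c ^ 2 * x' := ⟨v / c ^ 2, by field_simp⟩
    obtain ⟨v', rfl⟩ : ∃ x', v' = e ^ 2 * x' := ⟨v' / e ^ 2, by field_simp⟩
    have t3' : x + (y + (v + v')) = a + (b + (c + e)) := by
      rw [← t3]
      field_simp
    have t1' : x * a + (y * b + (v * c + v' * e)) = -g := by
      rw [hz'] at t1
      field_simp at t1
      linear_combination t1
    linear_combination a ^ 2 * t2 - a ^ 2 * (b + c + e) * t0 +
      a ^ 2 * (b * c + b * e + c * e) * t1' - a ^ 2 * b * c * e * t3' + a ^ 2 * hγ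
  have hx : x = -(a ^ 2 * ((b * c + b * e + c * e) * g + b * c * e * (b + (c + e)))) /
      ((a - b) * (a - c) * (a - e)) := by
    rw [← hx1]
    field_simp
  have hp : p = b / ((b - c) * (b - e)) *
      (-(c + e) * z + (c * e * a ^ 2 + z / a ^ 2) * x - x ^ 2 * ((a - c) * (a - e) / a)) := by
    field_simp at d1 ⊢
    linear_combination d1
  have key : b * (a ^ 3 * ((b * c + b * e + c * e) * g + b * c * e * (b + (c + e))) ^ 2 -
      (a - b) * ((c + e) * g ^ 3 * ((a - b) * (a - c) * (a - e)) +
        (g ^ 3 - c * e * a ^ 4) * ((b * c + b * e + c * e) * g + b * c * e * (b + (c + e))))) =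
      g ^ 2 * ((a ^ 2 + g) * (b ^ 2 + g) * (g + a * c + b * e) * (g + a * e + b * c)) := by
    -- The factorization holds only modulo `abce = g²`, so `e` is eliminated.
    have hE : e = g ^ 2 / (a * b * c) := by
      rw [hγ]
      field_simp
    rw [hE]
    field_simp
    ring
  generalize (b * c + b * e + c * e) * g + b * c * e * (b + (c + e)) = N at *
  trans b * (a ^ 3 * N ^ 2 -
      (a - b) * ((c + e) * g ^ 3 * ((a - b) * (a - c) * (a - e)) + (g ^ 3 - c * e * a ^ 4) * N))
  · rw [hp, hx, hz']
    field_simp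
    ring
  · rw [key, hz']
    field_simp

end IsBraidMatrix

end LowDimension

/-! ### Ranks, kernels and nilpotent maps -/

section Kernels

variable {K : Type w} [Field K] {V : Type v} [AddCommGroup V] [Module K V]
  [FiniteDimensional K V] (f : Module.End K V)

theorem mem_of_mem_roots_charpoly {p : K[X]} (hp : aeval f p = 0) {S : Finset K}
    (hS : ∀ x, p.IsRoot x → x ∈ S) {x : K} (hx : x ∈ f.charpoly.roots) : x ∈ S := by
  apply hS
  rw [mem_roots f.charpoly_monic.ne_zero, ← Module.End.hasEigenvalue_iff_isRoot_charpoly] at hx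
  exact (Module.End.hasEigenvalue_iff_isRoot.1 hx).dvd (minpoly.dvd K f hp)

theorem rootMultiplicity_eq_finrank_eigenspace {p : K[X]} (hp : aeval f p = 0)
    (hsq : Squarefree p) (x : K) :
    f.charpoly.rootMultiplicity x = Module.finrank K (f.eigenspace x) := by
  rw [← LinearMap.finrank_maxGenEigenspace_eq,
    (Module.End.isSemisimple_of_squarefree_aeval_eq_zero hsq hp
      ).isFinitelySemisimple.maxGenEigenspace_eq_eigenspace]

theorem finrank_ker_mul_le (g : Module.End K V) :
    Module.finrank K (LinearMap.ker (f * g)) ≤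
      Module.finrank K (LinearMap.ker f) + Module.finrank K (LinearMap.ker g) := by
  have h := LinearMap.finrank_range_add_finrank_ker (g.domRestrict (LinearMap.ker (f * g)))
  rw [← h]
  apply add_le_add
  · apply Submodule.finrank_mono
    rintro _ ⟨⟨x, hx⟩, rfl⟩
    exact hx
  · rw [← LinearMap.finrank_range_of_inj (f := (LinearMap.ker (f * g)).subtype.domRestrict
      (LinearMap.ker (g.domRestrict (LinearMap.ker (f * g)))))
      (fun x y hxy => Subtype.ext (Subtype.ext hxy))]
    apply Submodule.finrank_mono
    rintro _ ⟨⟨x, hx⟩, rfl⟩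
    exact hx

variable {f}

/-- Restricted to its range, `f` has range `range (f²)`, and its kernel there contains `range (f²)`
because `f³ = 0`. -/
theorem two_mul_finrank_range_sq_le (hf : f ^ 3 = 0) :
    2 * Module.finrank K (LinearMap.range (f ^ 2)) ≤ Module.finrank K (LinearMap.range f) := by
  have h := LinearMap.finrank_range_add_finrank_ker (f.domRestrict (LinearMap.range f))
  rw [← h, two_mul]
  apply add_le_add
  · apply Submodule.finrank_mono
    rintro _ ⟨x, rfl⟩
    exact ⟨⟨f x, x, rfl⟩, by simp [pow_two]⟩
  · let e : LinearMap.range (f ^ 2) →ₗ[K] LinearMap.range f :=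
      Submodule.inclusion (by
        rintro _ ⟨x, rfl⟩
        exact ⟨f x, by simp [pow_two]⟩)
    have he : Function.Injective e := Submodule.inclusion_injective _
    rw [← LinearMap.finrank_range_of_inj he]
    apply Submodule.finrank_mono
    rintro _ ⟨⟨_, x, rfl⟩, rfl⟩
    change f ((f ^ 2) x) = 0
    have := LinearMap.congr_fun hf x
    rwa [pow_succ'] at this

theorem finrank_range_sq_le_one (hf : f ^ 3 = 0) (hV : Module.finrank K V ≤ 5) :
    Module.finrank K (LinearMap.range (f ^ 2)) ≤ 1 := by
  have h1 := two_mul_finrank_range_sq_le hf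
  have h2 := LinearMap.finrank_range_add_finrank_ker f
  have h3 : Module.finrank K (LinearMap.range (f ^ 2)) ≤ Module.finrank K (LinearMap.ker f) := by
    apply Submodule.finrank_mono
    rintro _ ⟨x, rfl⟩
    have := LinearMap.congr_fun hf x
    rwa [pow_succ'] at this
  omega

theorem exists_mul_eq_of_finrank_range_le_one {d : ℕ} {M : Matrix (Fin d) (Fin d) K}
    (h : Module.finrank K (LinearMap.range (Matrix.toLin' M)) ≤ 1) :
    ∃ x y : Fin d → K, ∀ r s, M r s = x r * y s := by
  obtain ⟨⟨x, _⟩, hx⟩ := finrank_le_one_iff.1 h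
  have key : ∀ s, ∃ c : K, ∀ r, M r s = x r * c := by
    intro s
    obtain ⟨c, hc⟩ := hx ⟨_, Pi.single s 1, rfl⟩
    refine ⟨c, fun r => ?_⟩
    have h1 := congrFun (congrArg Subtype.val hc) r
    simp only [Matrix.toLin'_apply, Matrix.mulVec_single_one] at h1
    change c * x r = M r s at h1
    rw [← h1, mul_comm]
  choose y hy using key
  exact ⟨x, y, fun r s => hy s r⟩

end Kernels

/-! ### Algebraic multiplicities of square roots of scalars -/

section Multiplicities

variable {K : Type w} [Field K] [IsAlgClosed K] {V : Type v} [AddCommGroup V] [Module K V]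
  [FiniteDimensional K V] (f : Module.End K V)

theorem sum_rootMultiplicity {p : K[X]} (hp : aeval f p = 0) {S : Finset K}
    (hS : ∀ x, p.IsRoot x → x ∈ S) :
    ∑ x ∈ S, f.charpoly.rootMultiplicity x = Module.finrank K V := by
  classical
  rw [Finset.sum_congr rfl fun x _ => (count_roots f.charpoly (a := x)).symm,
    Multiset.sum_count_eq_card fun x hx => mem_of_mem_roots_charpoly f hp hS hx,
    splits_iff_card_roots.1 (IsAlgClosed.splits f.charpoly), f.charpoly_natDegree]

theorem trace_eq_sum_rootMultiplicity {p : K[X]} (hp : aeval f p = 0) {S : Finset K}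
    (hS : ∀ x, p.IsRoot x → x ∈ S) :
    LinearMap.trace K V f = ∑ x ∈ S, f.charpoly.rootMultiplicity x • x := by
  classical
  rw [Finset.sum_congr rfl fun x _ => by rw [← count_roots],
    Module.End.trace_eq_sum_roots_charpoly_of_splits (IsAlgClosed.splits _)]
  exact Finset.sum_multiset_count_of_subset _ _ fun x hx =>
    mem_of_mem_roots_charpoly f hp hS (Multiset.mem_toFinset.1 hx)

theorem det_eq_prod_rootMultiplicity {p : K[X]} (hp : aeval f p = 0) {S : Finset K}
    (hS : ∀ x, p.IsRoot x → x ∈ S) :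
    LinearMap.det f = ∏ x ∈ S, x ^ f.charpoly.rootMultiplicity x := by
  classical
  rw [Finset.prod_congr rfl fun x _ => by rw [← count_roots],
    Module.End.det_eq_prod_roots_charpoly_of_splits (IsAlgClosed.splits _)]
  exact Finset.prod_multiset_count_of_subset _ _ fun x hx =>
    mem_of_mem_roots_charpoly f hp hS (Multiset.mem_toFinset.1 hx)

variable {f}

/-- Multiplicities of the eigenvalues of a square root of a scalar. -/
theorem exists_multiplicities_of_sq {t : K} (ht : t ≠ 0) (hf : f * f = algebraMap K _ (t ^ 2)) :
    ∃ a b : ℕ, a + b = Module.finrank K V ∧ LinearMap.trace K V f = a * t - b * t ∧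
      LinearMap.det f = t ^ a * (-t) ^ b ∧
      ((2 : K) ≠ 0 → a = Module.finrank K (f.eigenspace t) ∧
        b = Module.finrank K (f.eigenspace (-t))) := by
  classical
  have hp : aeval f (X ^ 2 - C (t ^ 2)) = 0 := by
    simp [pow_two f, hf]
  by_cases h2 : (2 : K) = 0
  -- In characteristic two `t = -t`, and the whole multiplicity is assigned to `t`.
  · have hS : ∀ x, (X ^ 2 - C (t ^ 2) : K[X]).IsRoot x → x ∈ ({t} : Finset K) := by
      intro x hx
      simp only [IsRoot, eval_sub, eval_pow, eval_X, eval_C] at hx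
      have : (x - t) ^ 2 = 0 := by linear_combination hx + t * (t - x) * h2
      simpa [sub_eq_zero] using this
    have h1 := sum_rootMultiplicity f hp hS
    have h3 := trace_eq_sum_rootMultiplicity f hp hS
    have h4 := det_eq_prod_rootMultiplicity f hp hS
    rw [Finset.sum_singleton] at h1 h3
    rw [Finset.prod_singleton] at h4
    exact ⟨f.charpoly.rootMultiplicity t, 0, h1, by rw [h3]; simp, by rw [h4]; simp,
      fun h => (h h2).elim⟩
  · have htt : t ≠ -t := fun h => mul_ne_zero h2 ht (by linear_combination h)
    have hS : ∀ x, (X ^ 2 - C (t ^ 2) : K[X]).IsRoot x → x ∈ ({t, -t} : Finset K) := by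
      intro x hx
      simp only [IsRoot, eval_sub, eval_pow, eval_X, eval_C] at hx
      have : (x - t) * (x + t) = 0 := by linear_combination hx
      simpa [sub_eq_zero, eq_neg_iff_add_eq_zero] using this
    have hsq : Squarefree (X ^ 2 - C (t ^ 2) : K[X]) := by
      apply Separable.squarefree
      exact separable_X_pow_sub_C (t ^ 2) (by exact_mod_cast h2) (pow_ne_zero 2 ht)
    have h1 := sum_rootMultiplicity f hp hS
    have h3 := trace_eq_sum_rootMultiplicity f hp hS
    have h4 := det_eq_prod_rootMultiplicity f hp hS
    rw [Finset.sum_pair htt] at h1 h3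
    rw [Finset.prod_pair htt] at h4
    refine ⟨_, _, h1, ?_, h4, fun _ => ⟨?_, ?_⟩⟩
    · rw [h3]
      simp only [nsmul_eq_mul]
      ring
    · exact rootMultiplicity_eq_finrank_eigenspace f hp hsq _
    · exact rootMultiplicity_eq_finrank_eigenspace f hp hsq _

end Multiplicities

/-! ### Cube roots of scalars, and pairs without common eigenvectors in dimension five -/

section CubeRoots

theorem eigenspace_eq_ker {K : Type w} [Field K] {V : Type v} [AddCommGroup V]
    [Module K V] (f : Module.End K V) (x : K) :
    f.eigenspace x = LinearMap.ker (f - algebraMap K _ x) := by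
  rw [Module.End.eigenspace_def, Algebra.algebraMap_eq_smul_one]

variable {K : Type w} [Field K] [IsAlgClosed K] {V : Type v} [AddCommGroup V] [Module K V]
  [FiniteDimensional K V]

theorem exists_primitive_cube_root (h3 : (3 : K) ≠ 0) :
    ∃ ω : K, ω ^ 2 + ω + 1 = 0 ∧ ω ≠ 1 ∧ ω ^ 2 ≠ 1 ∧ ω ≠ 0 := by
  obtain ⟨ω, hω⟩ := IsAlgClosed.exists_root (X ^ 2 + X + 1 : K[X]) (by
    have : (X ^ 2 + X + 1 : K[X]).degree = 2 := by compute_degree!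
    rw [this]
    decide)
  have hω : ω ^ 2 + ω + 1 = 0 := by simpa using hω
  refine ⟨ω, hω, ?_, ?_, ?_⟩
  · rintro rfl
    exact h3 (by linear_combination hω)
  · intro h
    have h2 : ω = -2 := by linear_combination hω - h
    rw [h2] at h
    exact h3 (by linear_combination h)
  · rintro rfl
    simp at hω

/-- Multiplicities of the eigenvalues of a cube root of a scalar, away from characteristic `3`. -/
theorem exists_multiplicities_of_cube (h3 : (3 : K) ≠ 0) {g : Module.End K V} {u : K} (hu : u ≠ 0)
    (hg : g ^ 3 = algebraMap K _ (u ^ 3)) :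
    ∃ ω : K, ω ^ 2 + ω + 1 = 0 ∧ ω ≠ 0 ∧ ∃ a b c : ℕ, a + b + c = Module.finrank K V ∧
      LinearMap.trace K V g = a * u + b * (ω * u) + c * (ω ^ 2 * u) ∧
      LinearMap.det g = u ^ a * (ω * u) ^ b * (ω ^ 2 * u) ^ c ∧
      a = Module.finrank K (g.eigenspace u) ∧ b = Module.finrank K (g.eigenspace (ω * u)) ∧
      c = Module.finrank K (g.eigenspace (ω ^ 2 * u)) := by
  classical
  obtain ⟨ω, hω, h1, h2, h0⟩ := exists_primitive_cube_root h3
  have hp : aeval g (X ^ 3 - C (u ^ 3)) = 0 := by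
    simp [hg]
  have hω3 : ω ^ 3 = 1 := by linear_combination (ω - 1) * hω
  have n1 : u ≠ ω * u := fun h => h1 (mul_right_cancel₀ hu (by rw [← h, one_mul]))
  have n2 : u ≠ ω ^ 2 * u := fun h => h2 (mul_right_cancel₀ hu (by rw [← h, one_mul]))
  have n3 : ω * u ≠ ω ^ 2 * u := fun h => h1 (by
    have := mul_right_cancel₀ hu h
    apply mul_left_cancel₀ h0
    linear_combination -this)
  have hS : ∀ x, (X ^ 3 - C (u ^ 3) : K[X]).IsRoot x → x ∈ ({u, ω * u, ω ^ 2 * u} : Finset K) := by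
    intro x hx
    simp only [IsRoot, eval_sub, eval_pow, eval_X, eval_C] at hx
    have : (x - u) * ((x - ω * u) * (x - ω ^ 2 * u)) = 0 := by
      linear_combination hx + (-x ^ 2 * u + x * u ^ 2) * hω +
        (x * u ^ 2 - u ^ 3) * hω3
    simpa [sub_eq_zero] using this
  have hsq : Squarefree (X ^ 3 - C (u ^ 3) : K[X]) := by
    apply Separable.squarefree
    exact separable_X_pow_sub_C (u ^ 3) (by exact_mod_cast h3) (pow_ne_zero 3 hu)
  have e1 := sum_rootMultiplicity g hp hS
  have e3 := trace_eq_sum_rootMultiplicity g hp hS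
  have e4 := det_eq_prod_rootMultiplicity g hp hS
  have m1 : u ∉ ({ω * u, ω ^ 2 * u} : Finset K) := by simp [n1, n2]
  rw [Finset.sum_insert m1, Finset.sum_pair n3] at e1 e3
  rw [Finset.prod_insert m1, Finset.prod_pair n3] at e4
  refine ⟨ω, hω, h0, _, _, _, by rw [add_assoc]; exact e1, ?_, by rw [mul_assoc]; exact e4,
    rootMultiplicity_eq_finrank_eigenspace g hp hsq _,
    rootMultiplicity_eq_finrank_eigenspace g hp hsq _,
    rootMultiplicity_eq_finrank_eigenspace g hp hsq _⟩
  rw [e3]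
  simp only [nsmul_eq_mul]
  ring

/-- Trace and determinant of a cube root of a nonzero scalar on a space of dimension five, when
no eigenspace has dimension greater than two. -/
theorem exists_trace_det_of_cube (hV : Module.finrank K V = 5) {g : Module.End K V} {z : K}
    (hz : z ≠ 0) (hg : g ^ 3 = algebraMap K _ z)
    (hle : ∀ u, Module.finrank K (g.eigenspace u) ≤ 2) :
    ∃ u, u ^ 3 = z ∧ LinearMap.trace K V g = -u ∧ LinearMap.det g = u ^ 5 ∧
      Module.finrank K (LinearMap.range (g ^ 2 + u • g + algebraMap K _ (u ^ 2))) ≤ 1 ∧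
      ∃ x, 2 ≤ Module.finrank K (g.eigenspace x) := by
  obtain ⟨u, rfl⟩ := IsAlgClosed.exists_pow_nat_eq z (n := 3) (by norm_num)
  have hu : u ≠ 0 := by
    rintro rfl
    simp at hz
  by_cases h3 : (3 : K) = 0
  -- In characteristic three `g - u` is nilpotent of order at most three, and `g² + ug + u² = (g -
  -- u)²`.
  · have hp : aeval g ((X - C u) ^ 3) = 0 := by
      have : ((X - C u) ^ 3 : K[X]) = X ^ 3 - C (u ^ 3) := by
        have hC : (3 : K[X]) = 0 := by rw [← map_ofNat (C : K →+* K[X]) 3, h3, C_0]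
        rw [C_pow]
        linear_combination (X * C u ^ 2 - X ^ 2 * C u) * hC
      rw [this]
      simp [hg]
    have hS : ∀ x, ((X - C u) ^ 3 : K[X]).IsRoot x → x ∈ ({u} : Finset K) := by
      intro x hx
      simpa [IsRoot, sub_eq_zero] using hx
    have e1 := sum_rootMultiplicity g hp hS
    have e3 := trace_eq_sum_rootMultiplicity g hp hS
    have e4 := det_eq_prod_rootMultiplicity g hp hS
    rw [Finset.sum_singleton] at e1 e3
    rw [Finset.prod_singleton] at e4
    rw [e1, hV] at e3 e4
    have hN : (g - algebraMap K _ u) ^ 3 = 0 := by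
      simpa using hp
    refine ⟨u, rfl, ?_, e4, ?_, u, ?_⟩
    · rw [e3, nsmul_eq_mul]
      push_cast
      linear_combination 2 * u * h3
    · have : g ^ 2 + u • g + algebraMap K _ (u ^ 2) = (g - algebraMap K _ u) ^ 2 := by
        have h : aeval g (X ^ 2 + C u * X + C (u ^ 2)) = aeval g ((X - C u) ^ 2) := by
          congr 1
          have hC : (3 : K[X]) = 0 := by rw [← map_ofNat (C : K →+* K[X]) 3, h3, C_0]
          rw [C_pow]
          linear_combination X * C u * hC
        simpa [Algebra.smul_def] using h
      rw [this]
      exact finrank_range_sq_le_one hN hV.le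
    -- The kernel of the cube of `g - u` is everything, so `5 ≤ 3 · dim ker (g - u)`.
    · have k1 := finrank_ker_mul_le (g - algebraMap K _ u)
        ((g - algebraMap K _ u) * (g - algebraMap K _ u))
      have k2 := finrank_ker_mul_le (g - algebraMap K _ u) (g - algebraMap K _ u)
      rw [← pow_two, ← pow_succ', hN, LinearMap.ker_zero, finrank_top, hV] at k1
      rw [← pow_two] at k2
      rw [eigenspace_eq_ker]
      omega
  · obtain ⟨ω, hω, hω0, a, b, c, hsum, htr, hdet, ha, hb, hc⟩ :=
      exists_multiplicities_of_cube h3 hu hg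
    have hω3 : ω ^ 3 = 1 := by linear_combination (ω - 1) * hω
    have la := hle u
    have lb := hle (ω * u)
    have lc := hle (ω ^ 2 * u)
    rw [← ha] at la
    rw [← hb] at lb
    rw [← hc] at lc
    rw [hV] at hsum
    -- Since `(g - x)(g² + xg + x²) = 0`, the range lies in the eigenspace of `x`.
    have hr : ∀ x, x ^ 3 = u ^ 3 → Module.finrank K (g.eigenspace x) ≤ 1 →
        Module.finrank K (LinearMap.range (g ^ 2 + x • g + algebraMap K _ (x ^ 2))) ≤ 1 := by
      intro x hx h1
      refine le_trans (Submodule.finrank_mono ?_) h1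
      rw [eigenspace_eq_ker, LinearMap.range_le_ker_iff]
      change (g - algebraMap K _ x) * (g ^ 2 + x • g + algebraMap K _ (x ^ 2)) = 0
      have h : aeval g ((X - C x) * (X ^ 2 + C x * X + C (x ^ 2))) = aeval g (X ^ 3 - C (u ^ 3)) := by
        congr 1
        rw [← hx, C_pow, C_pow]
        ring
      have h' : aeval g (X ^ 3 - C (u ^ 3)) = 0 := by simp [hg]
      rw [h'] at h
      simpa [Algebra.smul_def] using h
    -- Three multiplicities, each at most two, with sum five. The simple eigenvalue serves as the
    -- witness `u`; the other two contribute `-2u` to the trace.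
    have hcases : (a = 1 ∧ b = 2 ∧ c = 2) ∨ (a = 2 ∧ b = 1 ∧ c = 2) ∨
        (a = 2 ∧ b = 2 ∧ c = 1) := by omega
    rcases hcases with ⟨rfl, rfl, rfl⟩ | ⟨rfl, rfl, rfl⟩ | ⟨rfl, rfl, rfl⟩
    · refine ⟨u, rfl, ?_, ?_, hr _ rfl ha.ge, ω * u, hb.le⟩
      · rw [htr]
        push_cast
        linear_combination 2 * u * hω
      · rw [hdet]
        linear_combination u ^ 5 * (ω ^ 3 + 1) * hω3
    · have hcube : (ω * u) ^ 3 = u ^ 3 := by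
        rw [mul_pow, hω3, one_mul]
      refine ⟨ω * u, hcube, ?_, ?_, hr _ hcube hb.ge, u, ha.le⟩
      · rw [htr]
        push_cast
        linear_combination 2 * u * hω
      · rw [hdet]
        ring
    · have hcube : (ω ^ 2 * u) ^ 3 = u ^ 3 := by
        linear_combination u ^ 3 * (ω ^ 3 + 1) * hω3
      refine ⟨ω ^ 2 * u, hcube, ?_, ?_, hr _ hcube hc.ge, u, ha.le⟩
      · rw [htr]
        push_cast
        linear_combination 2 * u * hω
      · rw [hdet]
        linear_combination -u ^ 5 * ω ^ 4 * (ω ^ 3 + 1) * hω3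

theorem exists_finrank_eigenspace_ge (hV : Module.finrank K V = 5) {f : Module.End K V} {z : K}
    (hf : f * f = algebraMap K _ z) :
    ∃ t, t ^ 2 = z ∧ 3 ≤ Module.finrank K (f.eigenspace t) := by
  obtain ⟨t, rfl⟩ := IsAlgClosed.exists_pow_nat_eq z (n := 2) (by norm_num)
  have h := finrank_ker_mul_le (f - algebraMap K _ t) (f - algebraMap K _ (-t))
  have h0 : (f - algebraMap K _ t) * (f - algebraMap K _ (-t)) = 0 := by
    have h : aeval f ((X - C t) * (X - C (-t))) = aeval f (X * X - C (t ^ 2)) := by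
      congr 1
      rw [C_pow, C_neg]
      ring
    simpa [hf] using h
  rw [h0, LinearMap.ker_zero, finrank_top, hV, ← eigenspace_eq_ker,
    ← eigenspace_eq_ker] at h
  by_cases h3 : 3 ≤ Module.finrank K (f.eigenspace t)
  · exact ⟨t, rfl, h3⟩
  · exact ⟨-t, by ring, by omega⟩

/-- Traces and determinants of two generators of the modular group acting on a space of dimension
five without common eigenvectors. -/
theorem exists_trace_det_of_disjoint (hV : Module.finrank K V = 5) {f g : Module.End K V} {z : K}
    (hz : z ≠ 0) (hf : f * f = algebraMap K _ z) (hg : g ^ 3 = algebraMap K _ z)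
    (hdisj : ∀ t u, Disjoint (f.eigenspace t) (g.eigenspace u)) :
    ∃ t u, t ^ 2 = z ∧ u ^ 3 = z ∧ LinearMap.trace K V f = t ∧ LinearMap.det f = t ^ 5 ∧
      LinearMap.trace K V g = -u ∧ LinearMap.det g = u ^ 5 ∧
      Module.finrank K (LinearMap.range (g ^ 2 + u • g + algebraMap K _ (u ^ 2))) ≤ 1 := by
  obtain ⟨t, ht, h3⟩ := exists_finrank_eigenspace_ge hV hf
  have hle : ∀ t u, Module.finrank K (f.eigenspace t) + Module.finrank K (g.eigenspace u) ≤ 5 :=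
    fun t u => hV ▸ Submodule.finrank_add_finrank_le_of_disjoint (hdisj t u)
  -- An eigenspace of `f` of dimension at least three leaves room for at most two in any eigenspace
  -- of `g`. Conversely the eigenspace of `g` at `x` bounds those of `f` by three.
  obtain ⟨u, hu, htr, hdet, hr, x, hx⟩ := exists_trace_det_of_cube hV hz hg fun u => by
    have := hle t u
    omega
  refine ⟨t, u, ht, hu, ?_, ?_, htr, hdet, hr⟩ <;>
  have ht0 : t ≠ 0 := by
    rintro rfl
    exact hz (by rw [← ht]; ring)
  all_goals
    rw [← ht] at hf
    obtain ⟨a, b, hab, htr', hdet', hmul⟩ := exists_multiplicities_of_sq ht0 hf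
    rw [hV] at hab
    have h1 := hle t x
    by_cases h2 : (2 : K) = 0
  · have hab' : (a : K) + b = 5 := by rw [← Nat.cast_add, hab]; norm_num
    rw [htr']
    linear_combination t * hab' + (2 - b) * t * h2
  · obtain ⟨ha, hb⟩ := hmul h2
    obtain rfl : a = 3 := by omega
    obtain rfl : b = 2 := by omega
    rw [htr']
    push_cast
    ring
  · have : -t = t := by linear_combination -t * h2
    rw [hdet', this, ← pow_add, hab]
  · obtain ⟨ha, hb⟩ := hmul h2
    obtain rfl : a = 3 := by omega
    obtain rfl : b = 2 := by omega
    rw [hdet']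
    ring

end CubeRoots

/-! ### Existence of `γ`, and the five-dimensional case -/

section Gamma

namespace IsBraidMatrix

variable {K : Type w} [Field K] {d : ℕ} {T : Matrix (Fin d) (Fin d) K} {lam : Fin d → K} {z : K}

theorem det_ne_zero (h : IsBraidMatrix T lam z) : T.det ≠ 0 := by
  intro h0
  have := congrArg Matrix.det h.sq
  rw [Matrix.det_mul, h0, zero_mul, Matrix.det_smul, Matrix.det_one, mul_one] at this
  exact pow_ne_zero _ h.scalar_ne_zero this.symm

theorem det_eq (h : IsBraidMatrix T lam z) : T.det = (∏ i, lam i) ^ 3 := by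
  have h1 := congrArg Matrix.det h.rel
  have h2 := congrArg Matrix.det h.diagonal_mul_inv
  simp only [Matrix.det_mul, Matrix.det_diagonal, Matrix.det_one] at h1 h2
  apply mul_right_cancel₀ h.det_ne_zero
  generalize ∏ i, lam i = D at *
  generalize ∏ i, lam⁻¹ i = E at *
  linear_combination D * h1 - T.det ^ 2 * h2

theorem toLin'_mul_self (h : IsBraidMatrix T lam z) :
    Matrix.toLin' T * Matrix.toLin' T = algebraMap K (Module.End K (Fin d → K)) z := by
  rw [Module.End.mul_eq_comp, ← Matrix.toLin'_mul, h.sq, map_smul, Matrix.toLin'_one,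
    Algebra.algebraMap_eq_smul_one]
  rfl

theorem exists_gamma_four [IsAlgClosed K] {T : Matrix (Fin 4) (Fin 4) K} {lam : Fin 4 → K}
    (h : IsBraidMatrix T lam z) {o : Fin 4} (hT : ∀ s, s ≠ o → T o s ≠ 0) :
    ∃ γ, γ ^ 4 = ∏ i, lam i ∧ z = -γ ^ 6 := by
  obtain ⟨t, ht⟩ := IsAlgClosed.exists_pow_nat_eq z (n := 2) (by norm_num)
  have ht0 : t ≠ 0 := by
    rintro rfl
    exact h.scalar_ne_zero (by rw [← ht]; ring)
  have hf := h.toLin'_mul_self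
  rw [← ht] at hf
  obtain ⟨a, b, hab, htr, hdet, -⟩ := exists_multiplicities_of_sq ht0 hf
  rw [Module.finrank_fintype_fun_eq_card, Fintype.card_fin] at hab
  rw [Matrix.trace_toLin'_eq] at htr
  rw [LinearMap.det_toLin', h.det_eq] at hdet
  have h0 : T.trace = 0 := (h.diag_four hT).1
  rw [h0] at htr
  -- Away from characteristic two, trace zero forces the eigenvalues `t` and `-t` to have
  -- multiplicity two each, so `det T = t⁴`. In characteristic two the sign is immaterial.
  have hz2 : (∏ i, lam i) ^ 3 = z ^ 2 := by
    rw [hdet, ← ht]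
    obtain rfl : b = 4 - a := by omega
    by_cases h2 : (2 : K) = 0
    · have : -t = t := by linear_combination -t * h2
      rw [this, ← pow_add, hab]
      ring
    · have h4 : (4 : K) ≠ 0 := by
        have := mul_ne_zero h2 h2
        norm_num at this
        exact this
      have : a ≤ 4 := by omega
      interval_cases a
      · exact (mul_ne_zero h4 ht0 (by push_cast at htr; linear_combination htr)).elim
      · exact (mul_ne_zero h2 ht0 (by push_cast at htr; linear_combination htr)).elim
      · ring
      · exact (mul_ne_zero h2 ht0 (by push_cast at htr; linear_combination -htr)).elim
      · exact (mul_ne_zero h4 ht0 (by push_cast at htr; linear_combination -htr)).elim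
  have hD : ∏ i, lam i ≠ 0 := Finset.prod_ne_zero_iff.2 fun i _ => h.ne_zero i
  -- The two conditions on `γ` force `γ² = -z / ∏ λ_i`; by `hz2` either square root satisfies both.
  obtain ⟨γ, hγ⟩ := IsAlgClosed.exists_pow_nat_eq (-z / ∏ i, lam i) (n := 2) (by norm_num)
  generalize ∏ i, lam i = D at *
  have h0 := h.scalar_ne_zero
  refine ⟨γ, ?_, ?_⟩
  · have : γ ^ 4 = (γ ^ 2) ^ 2 := by ring
    rw [this, hγ]
    field_simp
    linear_combination -hz2
  · have : γ ^ 6 = (γ ^ 2) ^ 3 := by ring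
    rw [this, hγ]
    field_simp
    linear_combination hz2

theorem cube_mul_diagonal_inv (h : IsBraidMatrix T lam z) :
    (T * Matrix.diagonal lam⁻¹) * (T * Matrix.diagonal lam⁻¹) = Matrix.diagonal lam * T ∧
    (T * Matrix.diagonal lam⁻¹) ^ 3 = z • 1 := by
  have h1 : (T * Matrix.diagonal lam⁻¹) * (T * Matrix.diagonal lam⁻¹) =
      Matrix.diagonal lam * T := by
    rw [← mul_assoc, h.rel, mul_assoc, h.diagonal_mul_inv, mul_one]
  refine ⟨h1, ?_⟩
  rw [pow_succ, pow_two, h1, mul_assoc, ← mul_assoc T, h.sq, smul_mul_assoc, one_mul,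
    mul_smul_comm, h.diagonal_mul_inv]

/-- `σ₁σ₂σ₁` and `σ₁σ₂` have no common eigenvector. -/
theorem disjoint_eigenspace (h : IsBraidMatrix T lam z) {o : Fin d} (hd : 1 < d)
    (hT : ∀ s, s ≠ o → T o s ≠ 0) (hT' : ∀ s, s ≠ o → T s o ≠ 0) (t u : K) :
    Disjoint (Module.End.eigenspace (Matrix.toLin' T) t)
      (Module.End.eigenspace (Matrix.toLin' (T * Matrix.diagonal lam⁻¹)) u) := by
  rw [Submodule.disjoint_def]
  intro x hx hy
  rw [Module.End.mem_eigenspace_iff, Matrix.toLin'_apply] at hx hy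
  by_contra hx0
  obtain ⟨r, hr⟩ := Function.ne_iff.1 hx0
  -- Since `T · (T D⁻¹) = z D⁻¹`, a common eigenvector is also an eigenvector of `D⁻¹`, hence a
  -- multiple of a basis vector. Then a column of `T` would vanish off the diagonal.
  have hA : z • (Matrix.diagonal lam⁻¹).mulVec x = (u * t) • x := by
    rw [mul_smul, ← hx, ← Matrix.mulVec_smul T, ← hy, Matrix.mulVec_mulVec, ← mul_assoc, h.sq,
      smul_mul_assoc, one_mul, Matrix.smul_mulVec]
  have hA' : ∀ i, z * ((lam i)⁻¹ * x i) = u * t * x i := fun i => by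
    have := congrFun hA i
    simpa [Matrix.mulVec_diagonal] using this
  have hsupp : ∀ i, i ≠ r → x i = 0 := by
    intro i hi
    by_contra hxi
    have e1 : z * (lam i)⁻¹ = u * t := mul_right_cancel₀ hxi (by rw [← hA' i]; ring)
    have e2 : z * (lam r)⁻¹ = u * t := mul_right_cancel₀ hr (by rw [← hA' r]; ring)
    exact hi (h.injective (inv_injective (mul_left_cancel₀ h.scalar_ne_zero (e1.trans e2.symm))))
  have hcol : ∀ s, s ≠ r → T s r = 0 := by
    intro s hs
    have h1 := congrFun hx s
    rw [Matrix.mulVec, dotProduct, Finset.sum_eq_single r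
      (fun i _ hi => by rw [hsupp i hi, mul_zero]) (fun h => (h (Finset.mem_univ _)).elim),
      Pi.smul_apply, hsupp s hs, smul_zero] at h1
    exact (mul_eq_zero.1 h1).resolve_right hr
  by_cases hro : r = o
  · subst hro
    have : Nontrivial (Fin d) := Fin.nontrivial_iff_two_le.2 hd
    obtain ⟨s, hs⟩ := exists_ne r
    exact hT' s hs (hcol s hs)
  · exact hT r hro (hcol o fun h => hro h.symm)

/-- Modulo `X³ - u³`, the variable acts on `X² + uX + u²` as `u`, so this factor squares to `3u²`
times itself. -/
theorem sq_of_cube_eq {R : Type*} [Ring R] [Algebra K R] {U : R} {u : K}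
    (hU : U ^ 3 = algebraMap K R (u ^ 3)) :
    (U * U + u • U + algebraMap K R (u ^ 2)) * (U * U + u • U + algebraMap K R (u ^ 2)) =
      (3 * u ^ 2) • (U * U + u • U + algebraMap K R (u ^ 2)) := by
  have h : aeval U ((X * X + C u * X + C (u ^ 2)) * (X * X + C u * X + C (u ^ 2))) =
      aeval U ((X ^ 3 - C (u ^ 3)) * (X + 2 * C u) +
        C (3 * u ^ 2) * (X * X + C u * X + C (u ^ 2))) := by
    congr 1
    simp only [C_mul, C_pow, map_ofNat]
    ring
  simpa [Algebra.smul_def, hU] using h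

/-- The spectral data of an irreducible five-dimensional braid matrix. -/
theorem exists_spectral_five [IsAlgClosed K] {T : Matrix (Fin 5) (Fin 5) K} {lam : Fin 5 → K}
    (h : IsBraidMatrix T lam z) {o : Fin 5} (hT : ∀ s, s ≠ o → T o s ≠ 0)
    (hT' : ∀ s, s ≠ o → T s o ≠ 0) :
    ∃ γ, γ ^ 5 = ∏ i, lam i ∧ z = γ ^ 6 ∧ ∑ k, T k k = γ ^ 3 ∧
      ∑ k, T k k * (lam k)⁻¹ = -γ ^ 2 ∧ ∑ k, T k k * lam k = -γ ^ 4 ∧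
      ∃ x y : Fin 5 → K, ∀ r s, x r * y s =
        T r s * (lam r + γ ^ 2 * (lam s)⁻¹) + if r = s then γ ^ 4 else 0 := by
  set g := Matrix.toLin' (T * Matrix.diagonal lam⁻¹) with hgdef
  have hg2 : g ^ 2 = Matrix.toLin' (Matrix.diagonal lam * T) := by
    rw [pow_two, Module.End.mul_eq_comp, hgdef, ← Matrix.toLin'_mul, h.cube_mul_diagonal_inv.1]
  have hg : g ^ 3 = algebraMap K (Module.End K (Fin 5 → K)) z := by
    have := h.cube_mul_diagonal_inv.2
    rw [pow_succ, pow_two] at this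
    rw [pow_succ, pow_two, Module.End.mul_eq_comp, Module.End.mul_eq_comp, hgdef,
      ← Matrix.toLin'_mul, ← Matrix.toLin'_mul, this, map_smul, Matrix.toLin'_one,
      Algebra.algebraMap_eq_smul_one]
    rfl
  obtain ⟨t, u, ht, hu, htr, hdet, htr', hdet', hr⟩ := exists_trace_det_of_disjoint
    (by rw [Module.finrank_fintype_fun_eq_card, Fintype.card_fin]) h.scalar_ne_zero
    h.toLin'_mul_self hg (h.disjoint_eigenspace (by norm_num) hT hT')
  have hD : ∏ i, lam i ≠ 0 := Finset.prod_ne_zero_iff.2 fun i _ => h.ne_zero i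
  have hz0 := h.scalar_ne_zero
  have hu0 : u ≠ 0 := by
    rintro rfl
    exact hz0 (by rw [← hu]; ring)
  rw [LinearMap.det_toLin', h.det_eq] at hdet
  rw [hgdef, LinearMap.det_toLin', Matrix.det_mul, h.det_eq] at hdet'
  have hDinv := congrArg Matrix.det h.diagonal_mul_inv
  rw [Matrix.det_mul, Matrix.det_diagonal, Matrix.det_one] at hDinv
  rw [Matrix.trace_toLin'_eq] at htr htr'
  have hu2 : (t / u) ^ 2 = u := by
    field_simp
    rw [ht, hu]
  have hrank := exists_mul_eq_of_finrank_range_le_one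
    (M := Matrix.diagonal lam * T + u • (T * Matrix.diagonal lam⁻¹) + u ^ 2 • 1) (by
      rw [hg2, Algebra.algebraMap_eq_smul_one] at hr
      rw [map_add, map_add, map_smul, map_smul, Matrix.toLin'_one]
      exact hr)
  obtain ⟨x, y, hxy⟩ := hrank
  have hxy' : ∀ r s, x r * y s =
      T r s * (lam r + u * (lam s)⁻¹) + if r = s then u ^ 2 else 0 := by
    intro r s
    rw [← hxy, Matrix.add_apply, Matrix.add_apply, Matrix.smul_apply, Matrix.smul_apply,
      Matrix.mul_diagonal, Matrix.diagonal_mul, Matrix.one_apply, Pi.inv_apply]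
    simp only [smul_eq_mul]
    split_ifs <;> ring
  have hs1 : ∑ k, T k k * (lam k)⁻¹ = -u := by
    rw [← htr', Matrix.trace]
    refine Finset.sum_congr rfl fun k _ => ?_
    rw [Matrix.diag_apply, Matrix.mul_diagonal, Pi.inv_apply]
  -- Otherwise `λ_o λ_s = -u` for two different `s`, against injectivity. The nonzero entry allows
  -- `3u²` to be read off from `M² = 3u² M`.
  obtain ⟨s, hos, hs⟩ : ∃ s, o ≠ s ∧ x o * y s ≠ 0 := by
    obtain ⟨s, s', h1, h2, h3⟩ : ∃ s s' : Fin 5, o ≠ s ∧ o ≠ s' ∧ s ≠ s' := by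
      clear hT hT'
      revert o
      decide
    by_contra! hcon
    have key : ∀ s, o ≠ s → lam o * lam s = -u := by
      intro s hs
      have := hcon s hs
      rw [hxy', if_neg hs, add_zero] at this
      have h4 := (mul_eq_zero.1 this).resolve_left (hT s hs.symm)
      have := h.ne_zero s
      field_simp at h4
      linear_combination h4
    exact h3 (h.injective (mul_left_cancel₀ (h.ne_zero o) ((key s h1).trans (key s' h2).symm)))
  have hs2 : ∑ k, x k * y k = 3 * u ^ 2 := by
    have hM := sq_of_cube_eq (U := T * Matrix.diagonal lam⁻¹) (u := u) (by
      rw [h.cube_mul_diagonal_inv.2, hu, Algebra.algebraMap_eq_smul_one])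
    rw [h.cube_mul_diagonal_inv.1, Algebra.algebraMap_eq_smul_one] at hM
    have := congrFun (congrFun hM o) s
    rw [Matrix.mul_apply, Matrix.smul_apply, hxy] at this
    apply mul_right_cancel₀ hs
    rw [smul_eq_mul] at this
    rw [← this, Finset.sum_mul]
    refine Finset.sum_congr rfl fun k _ => ?_
    rw [hxy, hxy]
    ring
  -- The trace of `M = U² + uU + u²` is `Σ x_k y_k = 3u²`, where `trace U = -u`; what remains is
  -- `trace U²`.
  have hs3 : ∑ k, T k k * lam k = -u ^ 2 := by
    have e : ∑ k, x k * y k = ∑ k, T k k * lam k + u * ∑ k, T k k * (lam k)⁻¹ + 5 * u ^ 2 := by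
      rw [Finset.mul_sum, ← Finset.sum_add_distrib]
      have : (5 : K) * u ^ 2 = ∑ k : Fin 5, u ^ 2 := by simp
      rw [this, ← Finset.sum_add_distrib]
      refine Finset.sum_congr rfl fun k _ => ?_
      rw [hxy', if_pos rfl]
      ring
    rw [hs2, hs1] at e
    linear_combination -e
  have hu4 : (t / u) ^ 4 = u ^ 2 := by
    have : (t / u) ^ 4 = ((t / u) ^ 2) ^ 2 := by ring
    rw [this, hu2]
  -- With `γ = t/u` one has `γ² = u` and `γ³ = t`, while `γ⁵ = det T / det U = det D`.
  refine ⟨t / u, ?_, ?_, ?_, by rw [hu2, hs1], by rw [hu4, hs3], x, y, by rw [hu2, hu4]; exact hxy'⟩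
  · rw [div_pow, ← hdet, ← hdet']
    generalize ∏ i, lam i = D at *
    rw [div_eq_iff (by
      rw [hdet']
      exact pow_ne_zero 5 hu0)]
    linear_combination -D ^ 3 * hDinv
  · have : (t / u) ^ 6 = ((t / u) ^ 2) ^ 3 := by ring
    rw [this, hu2, hu]
  · have : (t / u) ^ 3 = (t / u) ^ 2 * (t / u) := by ring
    rw [this, hu2]
    field_simp
    exact htr

/-- The weighted traces of orders `-2` to `2` are now all known, and interpolation gives `T_rr`. The
left side contains the diagonal entry of the matrix of rank at most one, which is what factors. -/
theorem diag_five {T : Matrix (Fin 5) (Fin 5) K} {lam : Fin 5 → K} (h : IsBraidMatrix T lam z)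
    {γ : K} (hγ : γ ^ 5 = ∏ i, lam i) (hz : z = γ ^ 6) (t0 : ∑ k, T k k = γ ^ 3)
    (t1 : ∑ k, T k k * (lam k)⁻¹ = -γ ^ 2) (t2 : ∑ k, T k k * lam k = -γ ^ 4)
    {r k l m n : Fin 5} (hl : [r, k, l, m, n].Nodup) :
    (T r r * (lam r + γ ^ 2 * (lam r)⁻¹) + γ ^ 4) * (polyP lam r).eval (lam r) * (lam r * γ) =
      (γ ^ 2 + lam r * γ + lam r ^ 2) * ((γ ^ 2 + lam r * lam k) * (γ ^ 2 + lam r * lam l) *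
        ((γ ^ 2 + lam r * lam m) * (γ ^ 2 + lam r * lam n))) := by
  have hne : ∀ i, lam i ≠ 0 := h.ne_zero
  have t3 := h.sum_diag_inv_sq
  have t4 := h.sum_diag_sq
  rw [eval_polyP_eq_list_prod lam hl rfl]
  rw [sum_univ_eq_list_sum hl rfl] at t0 t1 t2
  rw [sum_univ_eq_list_sum hl rfl, sum_univ_eq_list_sum hl rfl] at t3 t4
  rw [prod_univ_eq_list_prod hl rfl] at hγ
  have ha := hne r
  have hb := hne k
  have hc := hne l
  have hd := hne m
  have he := hne n
  clear hne h
  simp only [List.map_cons, List.map_nil, List.sum_cons, List.sum_nil, List.prod_cons,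
    List.prod_nil, add_zero, mul_one] at *
  generalize T r r = x₁ at *
  generalize T k k = x₂ at *
  generalize T l l = x₃ at *
  generalize T m m = x₄ at *
  generalize T n n = x₅ at *
  generalize lam r = a at *
  generalize lam k = b at *
  generalize lam l = c at *
  generalize lam m = d at *
  generalize lam n = e at *
  obtain ⟨x₁, rfl⟩ : ∃ x', x₁ = a ^ 2 * x' := ⟨x₁ / a ^ 2, by field_simp⟩
  obtain ⟨x₂, rfl⟩ : ∃ x', x₂ = b ^ 2 * x' := ⟨x₂ / b ^ 2, by field_simp⟩
  obtain ⟨x₃, rfl⟩ : ∃ x', x₃ = c ^ 2 * x' := ⟨x₃ / c ^ 2, by field_simp⟩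
  obtain ⟨x₄, rfl⟩ : ∃ x', x₄ = d ^ 2 * x' := ⟨x₄ / d ^ 2, by field_simp⟩
  obtain ⟨x₅, rfl⟩ : ∃ x', x₅ = e ^ 2 * x' := ⟨x₅ / e ^ 2, by field_simp⟩
  have u3 : x₁ + (x₂ + (x₃ + (x₄ + x₅))) = a + (b + (c + (d + e))) := by
    rw [← t3]
    field_simp
  have u1 : x₁ * a + (x₂ * b + (x₃ * c + (x₄ * d + x₅ * e))) = -γ ^ 2 := by
    rw [← t1]
    field_simp
  have u4 : x₁ * a ^ 4 + (x₂ * b ^ 4 + (x₃ * c ^ 4 + (x₄ * d ^ 4 + x₅ * e ^ 4))) =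
      γ * (b * c * d * e + a * c * d * e + a * b * d * e + a * b * c * e + a * b * c * d) := by
    have hz6 : z = γ * (a * (b * (c * (d * e)))) := by
      rw [hz, ← hγ]
      ring
    rw [hz6] at t4
    have : a * (b * (c * (d * e))) * (a⁻¹ + (b⁻¹ + (c⁻¹ + (d⁻¹ + e⁻¹)))) =
        b * c * d * e + a * c * d * e + a * b * d * e + a * b * c * e + a * b * c * d := by
      field_simp
      ring
    rw [← this]
    linear_combination t4
  have hN : x₁ * ((a - b) * ((a - c) * ((a - d) * (a - e)))) =
      γ * (b * c * d * e + a * (b * c * d + b * c * e + b * d * e + c * d * e)) +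
        (b + c + d + e) * γ ^ 4 +
        (b * c + b * d + b * e + c * d + c * e + d * e) * γ ^ 3 +
        (b * c * d + b * c * e + b * d * e + c * d * e) * γ ^ 2 +
        b * c * d * e * (a + b + c + d + e) := by
    linear_combination u4 - (b + c + d + e) * t2 +
      (b * c + b * d + b * e + c * d + c * e + d * e) * t0 -
      (b * c * d + b * c * e + b * d * e + c * d * e) * u1 + b * c * d * e * u3
  have hself : a ^ 2 * x₁ * (a + γ ^ 2 * a⁻¹) = a * (a ^ 2 + γ ^ 2) * x₁ := by
    field_simp
  rw [hself]
  linear_combination a * γ * (a * (a ^ 2 + γ ^ 2)) * hN +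
    (-a * γ * (a ^ 2 + γ ^ 2) * (b + c + d + e) - a * γ ^ 4 - a ^ 2 * γ ^ 3 + a ^ 5 -
      γ ^ 5) * hγ

theorem apply_mul_apply_five [IsAlgClosed K] {T : Matrix (Fin 5) (Fin 5) K} {lam : Fin 5 → K}
    (h : IsBraidMatrix T lam z) {o : Fin 5} (hT : ∀ s, s ≠ o → T o s ≠ 0)
    (hT' : ∀ s, s ≠ o → T s o ≠ 0) {γ : K} (hγ : γ ^ 5 = ∏ i, lam i) (hz : z = γ ^ 6)
    {r s k l m : Fin 5} (hl : [r, s, k, l, m].Nodup) :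
    (polyP lam r).eval (lam r) * (polyP lam s).eval (lam s) * (T r s * T s r) =
      polyQ5 γ (lam r) (lam s) (lam k) (lam l) (lam m) * z := by
  obtain ⟨γ', hγ', hz', t0, t1, t2, x, y, hM⟩ := h.exists_spectral_five hT hT'
  have hD : ∏ i, lam i ≠ 0 := Finset.prod_ne_zero_iff.2 fun i _ => h.ne_zero i
  -- Both equal `z / ∏ λ_i`, so the two conditions determine `γ` uniquely.
  obtain rfl : γ' = γ := by
    apply mul_right_cancel₀ hD
    nth_rw 1 [← hγ']
    rw [← hγ, ← pow_succ', ← pow_succ', ← hz', ← hz]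
  have hγ0 : γ' ≠ 0 := by
    rintro rfl
    apply hD
    rw [← hγ]
    norm_num
  clear hγ' hz'
  have hne : ∀ i, lam i ≠ 0 := h.ne_zero
  have hdiag : ∀ r k l m n, [r, k, l, m, n].Nodup →
      x r * y r * (polyP lam r).eval (lam r) * (lam r * γ') =
        (γ' ^ 2 + lam r * γ' + lam r ^ 2) * ((γ' ^ 2 + lam r * lam k) * (γ' ^ 2 + lam r * lam l) *
          ((γ' ^ 2 + lam r * lam m) * (γ' ^ 2 + lam r * lam n))) := by
    intro r k l m n hl
    have hM' := hM r r
    rw [if_pos rfl] at hM'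
    rw [hM']
    exact h.diag_five hγ hz t0 t1 t2 hl
  -- In an outer product `M_rs M_sr = M_rr M_ss`, and off the diagonal `M_rs = T_rs (λ_r + γ²/λ_s)`.
  have hoff : ∀ r s, r ≠ s → T r s * T s r * (γ' ^ 2 + lam r * lam s) ^ 2 =
      lam r * lam s * ((x r * y r) * (x s * y s)) := by
    intro r s hrs
    have e : (x r * y r) * (x s * y s) = (x r * y s) * (x s * y r) := by ring
    rw [e, hM r s, hM s r, if_neg hrs, if_neg hrs.symm]
    have := hne r
    have := hne s
    field_simp
    ring
  have hzero : ∀ r s, r ≠ s → γ' ^ 2 + lam r * lam s = 0 → x r * y r = 0 := by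
    intro r s hrs h0
    obtain ⟨k, l, m, hl⟩ : ∃ k l m, [r, s, k, l, m].Nodup := by
      clear * - hrs
      revert r s
      decide
    have := hdiag r s k l m hl
    rw [h0, zero_mul, zero_mul, mul_zero] at this
    have h1 := (mul_eq_zero.1 this).resolve_right (mul_ne_zero (hne r) hγ0)
    exact (mul_eq_zero.1 h1).resolve_right (eval_polyP_self_ne_zero h.injective r)
  -- If `γ² + λ_r λ_s = 0` then `M_rr = 0`. For `q ≠ s` with `o ∈ {r, q}` the product `T_rq T_qr` is
  -- nonzero, so `hoff` gives `γ² + λ_r λ_q = 0` and `λ_q = λ_s`.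
  have hcon : ∀ r s, r ≠ s → s ≠ o → γ' ^ 2 + lam r * lam s = 0 → False := by
    intro r s hrs hso h0
    have hr := hzero r s hrs h0
    obtain ⟨q, hrq, hsq, hro⟩ : ∃ q, r ≠ q ∧ s ≠ q ∧ (r = o ∨ q = o) := by
      by_cases hro : r = o
      · obtain ⟨q, h1, h2⟩ : ∃ q, r ≠ q ∧ s ≠ q := by
          clear * -
          revert r s
          decide
        exact ⟨q, h1, h2, Or.inl hro⟩
      · exact ⟨o, hro, hso, Or.inr rfl⟩
    have hT0 : T r q * T q r ≠ 0 := by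
      rcases hro with rfl | rfl
      · exact mul_ne_zero (hT q hrq.symm) (hT' q hrq.symm)
      · exact mul_ne_zero (hT' r hrq) (hT r hrq)
    have h1 := hoff r q hrq
    rw [hr, zero_mul, mul_zero] at h1
    have h2 := pow_eq_zero_iff (two_ne_zero) |>.1 ((mul_eq_zero.1 h1).resolve_left hT0)
    exact hsq (h.injective (mul_left_cancel₀ (hne r) (by linear_combination h0 - h2)))
  have hnz : ∀ r s, r ≠ s → γ' ^ 2 + lam r * lam s ≠ 0 := by
    intro r s hrs h0
    by_cases hso : s = o
    · exact hcon s r hrs.symm (hso ▸ hrs) (by rw [mul_comm]; exact h0)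
    · exact hcon r s hrs hso h0
  have hrs : r ≠ s := by
    rintro rfl; simp at hl
  have d1 := hdiag r s k l m hl
  have d2 := hdiag s r k l m ((List.Perm.swap r s _).nodup_iff.2 hl)
  have d3 := hoff r s hrs
  have n1 := hnz r s hrs
  have ha := hne r
  have hb := hne s
  rw [polyQ5, hz]
  generalize (polyP lam r).eval (lam r) = p at *
  generalize (polyP lam s).eval (lam s) = q at *
  generalize T r s * T s r = w at *
  generalize x r * y r = v at *
  generalize x s * y s = v' at *
  clear * - d1 d2 d3 n1 ha hb hγ0
  generalize lam r = a at *
  generalize lam s = b at *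
  apply mul_right_cancel₀ (pow_ne_zero 2 n1)
  calc p * q * w * (γ' ^ 2 + a * b) ^ 2 = p * q * (w * (γ' ^ 2 + a * b) ^ 2) := by ring
    _ = (v * p * (a * γ')) * (v' * q * (b * γ')) / γ' ^ 2 := by
      rw [d3]
      field_simp
    _ = _ := by
      rw [d1, d2]
      field_simp

end IsBraidMatrix

end Gamma

/-! ### From braid group representations to braid matrices -/

section BraidRepresentations

theorem braidGen_rel : braidGen 0 * braidGen 1 * braidGen 0 = braidGen 1 * braidGen 0 * braidGen 1 := by
  have h : (PresentedGroup.mk braidRels (FreeGroup.of 0 * FreeGroup.of 1 * FreeGroup.of 0 *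
      (FreeGroup.of 1 * FreeGroup.of 0 * FreeGroup.of 1)⁻¹)) = 1 :=
    PresentedGroup.one_of_mem (rels := braidRels) (Set.mem_singleton _)
  rw [map_mul, map_inv, mul_inv_eq_one] at h
  simp only [map_mul] at h
  exact h

/-- The half twist `σ₁σ₂σ₁`. -/
def halfTwist : B3 := braidGen 0 * braidGen 1 * braidGen 0

theorem halfTwist_mul_zero : halfTwist * braidGen 0 = braidGen 1 * halfTwist := by
  rw [halfTwist]
  nth_rw 1 [braidGen_rel]
  simp only [mul_assoc]

theorem halfTwist_mul_one : halfTwist * braidGen 1 = braidGen 0 * halfTwist := by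
  rw [halfTwist]
  nth_rw 2 [braidGen_rel]
  simp only [mul_assoc]

theorem mul_aeval_of_mul_eq {K R : Type*} [CommRing K] [Ring R] [Algebra K R] {t a b : R}
    (h : t * a = b * t) (p : K[X]) : t * aeval a p = aeval b p * t := by
  induction p using Polynomial.induction_on' with
  | add p q hp hq => rw [map_add, map_add, mul_add, add_mul, hp, hq]
  | monomial n x =>
    rw [aeval_monomial, aeval_monomial, ← mul_assoc, ← Algebra.commutes, mul_assoc, mul_assoc]
    congr 1
    exact SemiconjBy.pow_right (show SemiconjBy t a b from h) n

theorem aeval_apply_of_apply_eq_smul {K : Type w} [Field K] {V : Type v} [AddCommGroup V]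
    [Module K V] {f : Module.End K V} {x : V} {a : K} (h : f x = a • x) (p : K[X]) :
    aeval f p x = p.eval a • x := by
  by_cases hx : x = 0
  · rw [hx, map_zero, smul_zero]
  · exact Module.End.aeval_apply_of_hasEigenvector
      ⟨Module.End.mem_eigenspace_iff.2 h, hx⟩

variable {K : Type w} [Field K] {V : Type v} [AddCommGroup V] [Module K V] {d : ℕ}

theorem repr_apply_of_basis {f : Module.End K V} {b : Module.Basis (Fin d) K V}
    {lam : Fin d → K} (h : ∀ i, f (b i) = lam i • b i) (x : V) (i : Fin d) :
    b.repr (f x) i = lam i * b.repr x i := by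
  have : b.coord i ∘ₗ f = lam i • b.coord i := by
    apply b.ext
    intro j
    by_cases hij : j = i
    · subst hij
      simp [h]
    · simp [h, hij]
  exact LinearMap.congr_fun this x

theorem hasEigenvalue_iff_of_basis {f : Module.End K V} {b : Module.Basis (Fin d) K V}
    {lam : Fin d → K} (h : ∀ i, f (b i) = lam i • b i) (μ : K) :
    f.HasEigenvalue μ ↔ ∃ i, μ = lam i := by
  constructor
  · intro hμ
    obtain ⟨x, hx, hx0⟩ := hμ.exists_hasEigenvector
    rw [Module.End.mem_eigenspace_iff] at hx
    by_contra! hne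
    apply hx0
    apply b.repr.injective
    ext i
    have h1 := repr_apply_of_basis h x i
    rw [hx, map_smul, Finsupp.smul_apply, smul_eq_mul] at h1
    have h2 : (μ - lam i) * b.repr x i = 0 := by linear_combination h1
    simpa using (mul_eq_zero.1 h2).resolve_left (sub_ne_zero.2 (hne i))
  · rintro ⟨i, rfl⟩
    exact Module.End.hasEigenvalue_of_hasEigenvector
      ⟨Module.End.mem_eigenspace_iff.2 (h i), b.ne_zero i⟩

theorem finrank_maxGenEigenspace_of_basis {f : Module.End K V} {b : Module.Basis (Fin d) K V}
    {lam : Fin d → K} (hinj : Function.Injective lam) (h : ∀ i, f (b i) = lam i • b i)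
    (i : Fin d) : Module.finrank K (f.maxGenEigenspace (lam i)) = 1 := by
  have key : f.maxGenEigenspace (lam i) = K ∙ b i := by
    apply le_antisymm
    · intro x hx
      rw [Module.End.mem_maxGenEigenspace] at hx
      obtain ⟨k, hk⟩ := hx
      have hpow : ∀ j, ((f - lam i • (1 : Module.End K V)) ^ k) (b j) =
          (lam j - lam i) ^ k • b j := by
        intro j
        have := aeval_apply_of_apply_eq_smul (h j) ((X - C (lam i)) ^ k)
        simpa [Algebra.algebraMap_eq_smul_one] using this
      have hz : ∀ j, j ≠ i → b.repr x j = 0 := by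
        intro j hj
        have h1 := repr_apply_of_basis (lam := fun j => (lam j - lam i) ^ k) hpow x j
        rw [hk] at h1
        simp only [map_zero, Finsupp.coe_zero, Pi.zero_apply] at h1
        exact (mul_eq_zero.1 h1.symm).resolve_left
          (pow_ne_zero _ (sub_ne_zero.2 (hinj.ne hj)))
      rw [Submodule.mem_span_singleton]
      refine ⟨b.repr x i, ?_⟩
      conv_rhs => rw [← b.sum_repr x]
      rw [Finset.sum_eq_single i (fun j _ hj => by rw [hz j hj, zero_smul])
        (fun h => (h (Finset.mem_univ _)).elim)]
    · rw [Submodule.span_singleton_le_iff_mem, Module.End.mem_maxGenEigenspace]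
      exact ⟨1, by simp [h]⟩
  rw [key]
  exact finrank_span_singleton (b.ne_zero i)

/-- A representation of the braid group on which `σ₁` has simple spectrum, with one
eigenprojection of `σ₂` in general position to all eigenprojections of `σ₁`. -/
structure IsGenericBraidRep (ρ : Representation K B3 V) (b : Module.Basis (Fin d) K V)
    (lam : Fin d → K) (o : Fin d) (c : Fin d → K) : Prop where
  apply_basis : ∀ i, ρ (braidGen 0) (b i) = lam i • b i
  ne_zero : ∀ i, lam i ≠ 0
  injective : Function.Injective lam
  coeff_ne_zero : ∀ i, c i ≠ 0
  compress : ∀ i, aeval (ρ (braidGen 1)) (polyP lam o) * aeval (ρ (braidGen 0)) (polyP lam i) *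
    aeval (ρ (braidGen 1)) (polyP lam o) = c i • aeval (ρ (braidGen 1)) (polyP lam o)

/-- The matrix of the half twist. -/
def twistMatrix (ρ : Representation K B3 V) (b : Module.Basis (Fin d) K V) :
    Matrix (Fin d) (Fin d) K :=
  LinearMap.toMatrix b b (ρ halfTwist)

theorem aeval_one_eq (ρ : Representation K B3 V) (p : K[X]) :
    aeval (ρ (braidGen 1)) p = ρ halfTwist * aeval (ρ (braidGen 0)) p * ρ halfTwist⁻¹ := by
  have e : ρ halfTwist * ρ (braidGen 0) = ρ (braidGen 1) * ρ halfTwist := by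
    rw [← map_mul, ← map_mul, halfTwist_mul_zero]
  rw [mul_aeval_of_mul_eq e, mul_assoc, ← map_mul, mul_inv_cancel, map_one, mul_one]

theorem repr_halfTwist (ρ : Representation K B3 V) (b : Module.Basis (Fin d) K V) (r s : Fin d) :
    b.repr (ρ halfTwist (b s)) r = twistMatrix ρ b r s := by
  rw [twistMatrix, LinearMap.toMatrix_apply]

namespace IsGenericBraidRep

variable {ρ : Representation K B3 V} {b : Module.Basis (Fin d) K V} {lam : Fin d → K} {o : Fin d}
  {c : Fin d → K}

theorem toMatrix_zero (h : IsGenericBraidRep ρ b lam o c) :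
    LinearMap.toMatrix b b (ρ (braidGen 0)) = Matrix.diagonal lam := by
  ext i j
  rw [LinearMap.toMatrix_apply, h.apply_basis, map_smul, Module.Basis.repr_self,
    Finsupp.smul_apply, Finsupp.single_apply, Matrix.diagonal_apply]
  by_cases hij : i = j
  · subst hij
    simp
  · simp [hij, Ne.symm hij]

theorem aeval_polyP_apply (h : IsGenericBraidRep ρ b lam o c) (r : Fin d) (x : V) :
    aeval (ρ (braidGen 0)) (polyP lam r) x =
      ((polyP lam r).eval (lam r) * b.repr x r) • b r := by
  conv_lhs => rw [← b.sum_repr x]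
  rw [map_sum, Finset.sum_eq_single r]
  · rw [map_smul, aeval_apply_of_apply_eq_smul (h.apply_basis r), smul_smul, mul_comm]
  · intro i _ hi
    rw [map_smul, aeval_apply_of_apply_eq_smul (h.apply_basis i), eval_polyP_of_ne lam hi,
      zero_smul, smul_zero]
  · exact fun h => (h (Finset.mem_univ _)).elim

theorem aeval_polyP_ne_zero (h : IsGenericBraidRep ρ b lam o c) (r : Fin d) :
    aeval (ρ (braidGen 0)) (polyP lam r) ≠ 0 := by
  intro h0
  have := LinearMap.congr_fun h0 (b r)
  rw [h.aeval_polyP_apply, Module.Basis.repr_self, Finsupp.single_eq_same, mul_one,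
    LinearMap.zero_apply] at this
  exact smul_ne_zero (eval_polyP_self_ne_zero h.injective r) (b.ne_zero r) this

/-- `P_r(A)` is a multiple of the coordinate projection to `b r`, and `P_s(B)` is its analogue for
`s` conjugated by the half twist. The sandwich therefore picks out single entries of `T` and `T⁻¹`.
-/
theorem relation (h : IsGenericBraidRep ρ b lam o c) (r s : Fin d) :
    aeval (ρ (braidGen 0)) (polyP lam r) * aeval (ρ (braidGen 1)) (polyP lam s) *
      aeval (ρ (braidGen 0)) (polyP lam r) =
    ((polyP lam r).eval (lam r) * (polyP lam s).eval (lam s) *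
      (twistMatrix ρ b r s * b.repr (ρ halfTwist⁻¹ (b r)) s)) •
        aeval (ρ (braidGen 0)) (polyP lam r) := by
  ext x
  rw [aeval_one_eq]
  simp only [Module.End.mul_apply, LinearMap.smul_apply, h.aeval_polyP_apply, map_smul,
    Finsupp.smul_apply, smul_eq_mul, repr_halfTwist, smul_smul]
  congr 1
  ring

/-- Conjugation by the half twist exchanges `σ₁` and `σ₂`, carrying `compress` into the case `r = o`
of `relation`. -/
theorem coeff_eq (h : IsGenericBraidRep ρ b lam o c) (i : Fin d) :
    c i = (polyP lam o).eval (lam o) * (polyP lam i).eval (lam i) *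
      (twistMatrix ρ b o i * b.repr (ρ halfTwist⁻¹ (b o)) i) := by
  have e : ρ halfTwist * ρ (braidGen 0) = ρ (braidGen 1) * ρ halfTwist := by
    rw [← map_mul, ← map_mul, halfTwist_mul_zero]
  have e' : ρ halfTwist * ρ (braidGen 1) = ρ (braidGen 0) * ρ halfTwist := by
    rw [← map_mul, ← map_mul, halfTwist_mul_one]
  have hinv : ρ halfTwist⁻¹ * ρ halfTwist = 1 := by
    rw [← map_mul, inv_mul_cancel, map_one]
  have h1 : ρ halfTwist * (aeval (ρ (braidGen 0)) (polyP lam o) *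
      aeval (ρ (braidGen 1)) (polyP lam i) * aeval (ρ (braidGen 0)) (polyP lam o)) =
      ρ halfTwist * (c i • aeval (ρ (braidGen 0)) (polyP lam o)) := by
    rw [mul_smul_comm, mul_aeval_of_mul_eq e, ← smul_mul_assoc, ← h.compress,
      ← mul_assoc, ← mul_assoc, mul_aeval_of_mul_eq e, mul_assoc _ (ρ halfTwist),
      mul_aeval_of_mul_eq e', mul_assoc, mul_assoc, mul_aeval_of_mul_eq e]
    simp only [mul_assoc]
  have h2 := congrArg (fun f => ρ halfTwist⁻¹ * f) h1
  simp only [← mul_assoc, hinv, one_mul] at h2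
  rw [h.relation] at h2
  exact (smul_left_injective K (h.aeval_polyP_ne_zero o) h2).symm

end IsGenericBraidRep

end BraidRepresentations

/-! ### Scalar full twist, irreducibility and the scalars `Q_rs` -/

section GenericBraidRep

variable {K : Type w} [Field K] {V : Type v} [AddCommGroup V] [Module K V] {d : ℕ}

namespace IsGenericBraidRep

variable {ρ : Representation K B3 V} {b : Module.Basis (Fin d) K V} {lam : Fin d → K} {o : Fin d}
  {c : Fin d → K}

theorem twistMatrix_rel (h : IsGenericBraidRep ρ b lam o c) :
    twistMatrix ρ b * Matrix.diagonal lam⁻¹ * twistMatrix ρ b =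
      Matrix.diagonal lam * twistMatrix ρ b * Matrix.diagonal lam := by
  have hD : Matrix.diagonal lam * Matrix.diagonal lam⁻¹ = 1 := by
    rw [Matrix.diagonal_mul_diagonal, ← Matrix.diagonal_one]
    congr 1
    funext i
    exact mul_inv_cancel₀ (h.ne_zero i)
  have h1 : twistMatrix ρ b = Matrix.diagonal lam *
      LinearMap.toMatrix b b (ρ (braidGen 1)) * Matrix.diagonal lam := by
    rw [← h.toMatrix_zero, ← LinearMap.toMatrix_mul, ← LinearMap.toMatrix_mul, ← map_mul,
      ← map_mul]
    rfl
  have h2 : LinearMap.toMatrix b b (ρ (braidGen 1)) * twistMatrix ρ b =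
      twistMatrix ρ b * Matrix.diagonal lam := by
    rw [← h.toMatrix_zero, twistMatrix, ← LinearMap.toMatrix_mul, ← LinearMap.toMatrix_mul,
      ← map_mul, ← map_mul, halfTwist_mul_zero]
  nth_rw 1 [h1]
  rw [mul_assoc _ (Matrix.diagonal lam) (Matrix.diagonal lam⁻¹), hD, mul_one, mul_assoc, h2,
    mul_assoc]

theorem exists_isBraidMatrix (h : IsGenericBraidRep ρ b lam o c) :
    ∃ z, IsBraidMatrix (twistMatrix ρ b) lam z ∧ ρ (halfTwist ^ 2) = z • (1 : V →ₗ[K] V) ∧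
      (∀ s, twistMatrix ρ b o s ≠ 0) ∧ (∀ s, twistMatrix ρ b s o ≠ 0) ∧
      ∀ r s, b.repr (ρ halfTwist⁻¹ (b r)) s = z⁻¹ * twistMatrix ρ b s r := by
  have hcomm : ρ (halfTwist ^ 2) * ρ (braidGen 0) = ρ (braidGen 0) * ρ (halfTwist ^ 2) := by
    rw [← map_mul, ← map_mul, pow_two, mul_assoc, halfTwist_mul_zero, ← mul_assoc,
      halfTwist_mul_one, mul_assoc]
  -- The full twist commutes with `σ₁`, whose spectrum is simple, so it is diagonal.
  have heig : ∀ i, ∃ w : K, ρ (halfTwist ^ 2) (b i) = w • b i := by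
    intro i
    refine ⟨b.repr (ρ (halfTwist ^ 2) (b i)) i, ?_⟩
    have h1 := h.aeval_polyP_apply i (ρ (halfTwist ^ 2) (b i))
    have h2 := LinearMap.congr_fun (mul_aeval_of_mul_eq hcomm (polyP lam i)) (b i)
    rw [Module.End.mul_apply, Module.End.mul_apply, h1, h.aeval_polyP_apply, map_smul,
      Module.Basis.repr_self, Finsupp.single_eq_same, mul_one, mul_smul] at h2
    exact smul_right_injective V (eval_polyP_self_ne_zero h.injective i) h2
  choose w hw using heig
  have hcoeff : ∀ i, twistMatrix ρ b o i ≠ 0 ∧ b.repr (ρ halfTwist⁻¹ (b o)) i ≠ 0 := by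
    intro i
    have h1 := h.coeff_ne_zero i
    rw [h.coeff_eq] at h1
    exact ⟨left_ne_zero_of_mul (right_ne_zero_of_mul h1),
      right_ne_zero_of_mul (right_ne_zero_of_mul h1)⟩
  -- The full twist also commutes with the half twist. Since `Δ b_i` has a nonzero `o` coordinate,
  -- `w_i` and `w_o` agree.
  have hconst : ∀ i, w i = w o := by
    intro i
    have h1 : ρ (halfTwist ^ 2) (ρ halfTwist (b i)) = w i • ρ halfTwist (b i) := by
      rw [← map_smul, ← hw, ← Module.End.mul_apply, ← Module.End.mul_apply, ← map_mul, ← map_mul,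
        ← pow_succ, ← pow_succ']
    have h2 := repr_apply_of_basis hw (ρ halfTwist (b i)) o
    rw [h1, map_smul, Finsupp.smul_apply, smul_eq_mul, repr_halfTwist] at h2
    exact mul_right_cancel₀ (hcoeff i).1 h2
  have hz : ρ (halfTwist ^ 2) = w o • (1 : V →ₗ[K] V) := by
    apply b.ext
    intro i
    rw [hw, hconst]
    rfl
  have hz0 : w o ≠ 0 := by
    intro h0
    have h1 := hw o
    rw [h0, zero_smul] at h1
    apply b.ne_zero o
    calc b o = ρ ((halfTwist ^ 2)⁻¹ * halfTwist ^ 2) (b o) := by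
          rw [inv_mul_cancel, map_one, Module.End.one_apply]
      _ = 0 := by rw [map_mul, Module.End.mul_apply, h1, map_zero]
  have hinv : ρ halfTwist⁻¹ = (w o)⁻¹ • ρ halfTwist := by
    have h1 : ρ halfTwist = w o • ρ halfTwist⁻¹ := by
      calc ρ halfTwist = ρ (halfTwist ^ 2 * halfTwist⁻¹) := by
            congr 1
            group
        _ = _ := by
          rw [map_mul, hz, smul_mul_assoc, one_mul]
    rw [h1, smul_smul, inv_mul_cancel₀ hz0, one_smul]
  have hrepr : ∀ r s, b.repr (ρ halfTwist⁻¹ (b r)) s = (w o)⁻¹ * twistMatrix ρ b s r := by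
    intro r s
    rw [hinv, LinearMap.smul_apply, map_smul, Finsupp.smul_apply, repr_halfTwist, smul_eq_mul]
  refine ⟨w o, ⟨h.ne_zero, h.injective, hz0, ?_, h.twistMatrix_rel⟩, hz, fun s => (hcoeff s).1,
    fun s => ?_, hrepr⟩
  · rw [twistMatrix, ← LinearMap.toMatrix_mul, ← map_mul, ← pow_two, hz, map_smul,
      LinearMap.toMatrix_one]
  · have h1 := (hcoeff s).2
    rw [hrepr] at h1
    exact right_ne_zero_of_mul h1

/-- By simplicity of the spectrum of `σ₁`, a subrepresentation contains every basis vector occurring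
in one of its elements. The half twist leads from any basis vector to `b o` and from `b o` to all
others. -/
theorem isIrreducible (h : IsGenericBraidRep ρ b lam o c) : ρ.IsIrreducible := by
  obtain ⟨z, -, -, hT, hT', -⟩ := h.exists_isBraidMatrix
  have : Nontrivial (Subrepresentation ρ) := by
    refine ⟨⊥, ⊤, fun hbt => b.ne_zero o ?_⟩
    have h1 : b o ∈ (⊤ : Subrepresentation ρ).toSubmodule := Submodule.mem_top
    rw [← hbt] at h1
    exact (Submodule.mem_bot K).1 h1
  refine ⟨fun W => ?_⟩
  by_cases hW : ∀ x ∈ W.toSubmodule, x = 0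
  · left
    apply Subrepresentation.toSubmodule_injective
    exact (Submodule.eq_bot_iff _).2 hW
  right
  push Not at hW
  obtain ⟨x, hx, hx0⟩ := hW
  have hcomp : ∀ y ∈ W.toSubmodule, ∀ i, b.repr y i ≠ 0 → b i ∈ W.toSubmodule := by
    intro y hy i hi
    have h1 : aeval (ρ (braidGen 0)) (polyP lam i) y ∈ W.toSubmodule := by
      have key : ∀ p : K[X], aeval (ρ (braidGen 0)) p y ∈ W.toSubmodule := by
        intro p
        induction p using Polynomial.induction_on' with
        | add p q hp hq =>
          rw [map_add]
          exact W.toSubmodule.add_mem hp hq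
        | monomial n a =>
          rw [aeval_monomial, ← map_pow, Module.End.mul_apply, Module.algebraMap_end_apply]
          exact W.toSubmodule.smul_mem _ (W.apply_mem_toSubmodule _ hy)
      exact key _
    rw [h.aeval_polyP_apply] at h1
    exact (W.toSubmodule.smul_mem_iff
      (mul_ne_zero (eval_polyP_self_ne_zero h.injective i) hi)).1 h1
  obtain ⟨i, hi⟩ : ∃ i, b.repr x i ≠ 0 := by
    by_contra! hall
    exact hx0 (b.repr.map_eq_zero_iff.1 (Finsupp.ext hall))
  have ho : b o ∈ W.toSubmodule :=
    hcomp _ (W.apply_mem_toSubmodule halfTwist (hcomp x hx i hi)) o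
      (by rw [repr_halfTwist]; exact hT i)
  apply Subrepresentation.toSubmodule_injective
  apply (eq_top_iff).2
  change ⊤ ≤ W.toSubmodule
  rw [← b.span_eq, Submodule.span_le]
  rintro _ ⟨s, rfl⟩
  exact hcomp _ (W.apply_mem_toSubmodule halfTwist ho) s (by rw [repr_halfTwist]; exact hT' s)

theorem exists_basis_braidGen (h : IsGenericBraidRep ρ b lam o c) (j : Fin 2) :
    ∃ b' : Module.Basis (Fin d) K V, ∀ i, ρ (braidGen j) (b' i) = lam i • b' i := by
  fin_cases j
  · exact ⟨b, h.apply_basis⟩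
  · let e : V ≃ₗ[K] V := LinearEquiv.ofLinearMap (ρ halfTwist) (ρ halfTwist⁻¹)
      (by rw [← Module.End.mul_eq_comp, ← map_mul, mul_inv_cancel, map_one]; rfl)
      (by rw [← Module.End.mul_eq_comp, ← map_mul, inv_mul_cancel, map_one]; rfl)
    refine ⟨b.map e, fun i => ?_⟩
    rw [Module.Basis.map_apply]
    change ρ (braidGen 1) (ρ halfTwist (b i)) = lam i • ρ halfTwist (b i)
    rw [← Module.End.mul_apply, ← map_mul, ← halfTwist_mul_zero, map_mul, Module.End.mul_apply,
      h.apply_basis, map_smul]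

theorem _root_.BraidDim.isGamma_iff [Nontrivial V] (lam : Fin d → K) {z : K}
    (hz : ρ (halfTwist ^ 2) = z • (1 : V →ₗ[K] V)) (γ : K) :
    IsGamma ρ lam γ ↔ γ ^ d = ∏ i, lam i ∧ z = (-1) ^ (d + 1) * γ ^ 6 := by
  rw [IsGamma]
  refine and_congr_right fun _ => ?_
  change ρ (halfTwist ^ 2) = _ ↔ _
  rw [hz]
  exact (smul_left_injective K (one_ne_zero (α := V →ₗ[K] V))).eq_iff

theorem exists_isQFamily [IsAlgClosed K] (h : IsGenericBraidRep ρ b lam o c) :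
    ∃ Q : Fin d → Fin d → K, IsQFamily ρ lam Q ∧ ∀ i, Q o i = c i := by
  obtain ⟨z, hM, hz, hT, hT', hrepr⟩ := h.exists_isBraidMatrix
  have hz0 := hM.scalar_ne_zero
  have : Nontrivial V := ⟨b o, 0, b.ne_zero o⟩
  refine ⟨fun r s => (polyP lam r).eval (lam r) * (polyP lam s).eval (lam s) *
    (twistMatrix ρ b r s * b.repr (ρ halfTwist⁻¹ (b r)) s), ⟨?_, ?_, ?_, ?_, ?_⟩,
    fun i => (h.coeff_eq i).symm⟩
  · intro r s q
    rw [h.relation]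
    exact (smul_left_injective K (h.aeval_polyP_ne_zero r)).eq_iff.trans eq_comm
  all_goals
    intro hd
    subst hd
    simp only [hrepr]
  · intro r s hrs
    have := hM.apply_mul_apply_two (o := o) (fun s _ => hT s) hrs
    field_simp
    linear_combination this
  · intro r s k hl
    have := hM.apply_mul_apply_three (o := o) (fun s _ => hT s) hl
    field_simp
    linear_combination this
  · simp only [isGamma_iff lam hz]
    constructor
    · obtain ⟨γ, h1, h2⟩ := hM.exists_gamma_four (o := o) (fun s _ => hT s)
      exact ⟨γ, h1, by rw [h2]; ring⟩
    · rintro γ ⟨h1, h2⟩ r s k l hl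
      have := hM.apply_mul_apply_four (o := o) (fun s _ => hT s) h1 (by rw [h2]; ring) hl
      field_simp
      linear_combination this
  · simp only [isGamma_iff lam hz]
    constructor
    · obtain ⟨γ, h1, h2, -⟩ := hM.exists_spectral_five (o := o) (fun s _ => hT s) (fun s _ => hT' s)
      exact ⟨γ, h1, by rw [h2]; ring⟩
    · rintro γ ⟨h1, h2⟩ r s k l m hl
      have := hM.apply_mul_apply_five (o := o) (fun s _ => hT s) (fun s _ => hT' s) h1
        (by rw [h2]; ring) hl
      field_simp
      linear_combination this

end IsGenericBraidRep

end GenericBraidRep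

/-! ### Schur's lemma and self-duality -/

section Semisimple

variable {K : Type w} [Field K] {C : Type u} [Category.{v} C] [Preadditive C] [Linear K C]

theorem ScalarEnd.exists_smul {X : C} (h : ScalarEnd K X) (f : X ⟶ X) : ∃ a : K, f = a • 𝟙 X := by
  obtain ⟨a, ha⟩ := h.2 f
  exact ⟨a, ha.symm⟩

theorem ScalarEnd.id_ne_zero {X : C} (h : ScalarEnd K X) : 𝟙 X ≠ 0 := by
  intro h0
  apply one_ne_zero (α := K)
  apply h.1
  simp [h0]

theorem ScalarEnd.of_iso {X Y : C} (e : X ≅ Y) (hY : ScalarEnd K Y) : ScalarEnd K X := by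
  constructor
  · intro a b hab
    apply hY.1
    have := congrArg (fun f => e.inv ≫ f ≫ e.hom) hab
    simpa using this
  · intro f
    obtain ⟨a, ha⟩ := hY.2 (e.inv ≫ f ≫ e.hom)
    refine ⟨a, ?_⟩
    have := congrArg (fun f => e.hom ≫ f ≫ e.inv) ha
    simpa using this

variable [MonoidalCategory C]

theorem isIso_of_ne_zero [SemisimpleCategory K C] {X Y : C} (hX : ScalarEnd K X) (hY : ScalarEnd K Y) {f : X ⟶ Y}
    (hf : f ≠ 0) : IsIso f := by
  obtain ⟨e⟩ : Nonempty (X ≅ Y) := by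
    by_contra h
    exact hf (SemisimpleCategory.hom_eq_zero hX hY (not_nonempty_iff.1 h) f)
  obtain ⟨a, ha⟩ := hX.exists_smul (f ≫ e.inv)
  have hf' : f = a • e.hom := by
    rw [← Category.comp_id f, ← e.inv_hom_id, ← Category.assoc, ha, Linear.smul_comp,
      Category.id_comp]
  have ha0 : a ≠ 0 := by
    rintro rfl
    exact hf (by rw [hf', zero_smul])
  refine ⟨a⁻¹ • e.inv, ?_, ?_⟩
  · rw [hf', Linear.smul_comp, Linear.comp_smul, smul_smul, mul_inv_cancel₀ ha0, one_smul,
      e.hom_inv_id]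
  · rw [hf', Linear.smul_comp, Linear.comp_smul, smul_smul, inv_mul_cancel₀ ha0, one_smul,
      e.inv_hom_id]

variable (K) in
/-- Categorically simple objects have scalar endomorphisms. -/
theorem scalarEnd_of_simple [SemisimpleCategory K C] (X : C) [Simple X] :
    ScalarEnd K X := by
  obtain ⟨n, S, f, g, hS, hsum⟩ := SemisimpleCategory.domination (K := K) X
  obtain ⟨k, hk⟩ : ∃ k, f k ≫ g k ≠ 0 := by
    by_contra! h
    exact id_nonzero X (by rw [← hsum, Finset.sum_eq_zero fun k _ => h k])
  have hg : g k ≠ 0 := by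
    intro h
    exact hk (by rw [h, Limits.comp_zero])
  -- By domination it is enough to test against sources with scalar endomorphisms. A nonzero map
  -- from such an object to `S k` is invertible, which would force `g k = 0`.
  have hmono : Mono (g k) := by
    apply Preadditive.mono_of_cancel_zero
    intro W h hh
    obtain ⟨m, S', f', g', hS', hsum'⟩ := SemisimpleCategory.domination (K := K) W
    rw [← Category.id_comp h, ← hsum', Preadditive.sum_comp]
    apply Finset.sum_eq_zero
    intro l _
    have : g' l ≫ h = 0 := by
      by_contra hne
      have := isIso_of_ne_zero (hS' l) (hS k) hne
      apply hg
      rw [← cancel_epi (g' l ≫ h), Category.assoc, hh, Limits.comp_zero, Limits.comp_zero]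
    rw [Category.assoc, this, Limits.comp_zero]
  have := isIso_of_mono_of_nonzero hg
  exact (hS k).of_iso (asIso (g k)).symm

section Duals

variable [MonoidalPreadditive C] [MonoidalLinear K C]

variable (K) in
/-- `tensorLeftHomEquiv` as a linear equivalence. -/
def tensorLeftLinearEquiv (X Y Y' Z : C) [ExactPairing Y Y'] :
    (Y' ⊗ X ⟶ Z) ≃ₗ[K] (X ⟶ Y ⊗ Z) where
  __ := tensorLeftHomEquiv X Y Y' Z
  map_add' f g := by simp [tensorLeftHomEquiv]
  map_smul' a f := by simp [tensorLeftHomEquiv]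

variable (K) in
/-- `tensorRightHomEquiv` as a linear equivalence. -/
def tensorRightLinearEquiv (X Y Y' Z : C) [ExactPairing Y Y'] :
    (X ⊗ Y ⟶ Z) ≃ₗ[K] (X ⟶ Z ⊗ Y') where
  __ := tensorRightHomEquiv X Y Y' Z
  map_add' f g := by simp [tensorRightHomEquiv]
  map_smul' a f := by simp [tensorRightHomEquiv]

theorem tensorRightLinearEquiv_apply {X Y Y' Z : C} [ExactPairing Y Y'] (f : X ⊗ Y ⟶ Z) :
    tensorRightLinearEquiv K X Y Y' Z f =
      (ρ_ _).inv ≫ X ◁ η_ Y Y' ≫ (α_ _ _ _).inv ≫ f ▷ Y' :=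
  rfl

variable (K) in
theorem tensorLeftLinearEquiv_rightUnitor (Y Y' : C) [ExactPairing Y Y'] :
    tensorLeftLinearEquiv K (𝟙_ C) Y Y' Y' (ρ_ Y').hom = η_ Y Y' := by
  change (λ_ _).inv ≫ η_ _ _ ▷ _ ≫ (α_ _ _ _).hom ≫ _ ◁ (ρ_ Y').hom = _
  monoidal

variable (K) in
theorem tensorRightLinearEquiv_leftUnitor (Y Y' : C) [ExactPairing Y Y'] :
    tensorRightLinearEquiv K (𝟙_ C) Y Y' Y (λ_ Y).hom = η_ Y Y' := by
  change (ρ_ _).inv ≫ _ ◁ η_ _ _ ≫ (α_ _ _ _).inv ≫ (λ_ Y).hom ▷ _ = _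
  monoidal

theorem ScalarEnd.exists_coevaluation_smul {Y Y' : C} [ExactPairing Y Y'] (h : ScalarEnd K Y)
    (f : 𝟙_ C ⟶ Y ⊗ Y') : ∃ a : K, f = a • η_ Y Y' := by
  obtain ⟨a, ha⟩ := h.exists_smul
    ((λ_ Y).inv ≫ (tensorRightLinearEquiv K (𝟙_ C) Y Y' Y).symm f)
  refine ⟨a, ?_⟩
  rw [Iso.inv_comp_eq, Linear.comp_smul, Category.comp_id, LinearEquiv.symm_apply_eq, map_smul,
    tensorRightLinearEquiv_leftUnitor] at ha
  exact ha

theorem ScalarEnd.coevaluation_smul_injective {Y : C} (Y' : C) [ExactPairing Y Y']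
    (h : ScalarEnd K Y) : Function.Injective fun a : K => a • η_ Y Y' := by
  intro a b hab
  apply h.1
  simp only [← tensorRightLinearEquiv_leftUnitor K, ← map_smul] at hab
  have := congrArg (fun f => (λ_ Y).inv ≫ f) ((tensorRightLinearEquiv K _ _ _ _).injective hab)
  simpa using this

theorem ScalarEnd.of_exactPairing {Y Y' : C} [ExactPairing Y Y'] (h : ScalarEnd K Y) :
    ScalarEnd K Y' := by
  constructor
  · intro a b hab
    apply h.coevaluation_smul_injective Y'
    have := congrArg (fun f => tensorLeftLinearEquiv K (𝟙_ C) Y Y' Y' ((ρ_ Y').hom ≫ f)) hab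
    simpa [tensorLeftLinearEquiv_rightUnitor] using this
  · intro f
    obtain ⟨a, ha⟩ := h.exists_coevaluation_smul
      (tensorLeftLinearEquiv K (𝟙_ C) Y Y' Y' ((ρ_ Y').hom ≫ f))
    refine ⟨a, ?_⟩
    rw [← tensorLeftLinearEquiv_rightUnitor K, ← map_smul] at ha
    have := (tensorLeftLinearEquiv K _ _ _ _).injective ha
    rw [← cancel_epi (ρ_ Y').hom, this, Linear.comp_smul, Category.comp_id]

/-- The inclusion of the unit transposes to a nonzero map from the dual of `Z` to `Z`, an
isomorphism by Schur's lemma. -/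
theorem exists_exactPairing_self [SemisimpleCategory K C] {Z : C} [HasRightDual Z]
    (hZ : ScalarEnd K Z) (h : IsSelfDual K Z) : Nonempty (ExactPairing Z Z) := by
  obtain ⟨i, p, hip, -⟩ := h
  have hi : i ≠ 0 := by
    rintro rfl
    rw [Limits.zero_comp] at hip
    exact (SemisimpleCategory.scalarEnd_unit (K := K) (C := C)).id_ne_zero hip.symm
  have hφ : (ρ_ Zᘁ).inv ≫ (tensorLeftLinearEquiv K (𝟙_ C) Z Zᘁ Z).symm i ≠ 0 := by
    intro h0
    rw [Iso.inv_comp_eq, Limits.comp_zero, LinearEquiv.symm_apply_eq, map_zero] at h0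
    exact hi h0
  have := isIso_of_ne_zero (hZ.of_exactPairing (Y' := Zᘁ)) hZ hφ
  exact ⟨exactPairingCongrRight (asIso ((ρ_ Zᘁ).inv ≫
    (tensorLeftLinearEquiv K (𝟙_ C) Z Zᘁ Z).symm i)).symm⟩

theorem ScalarEnd.exists_evaluation_smul {Y Y' : C} [ExactPairing Y Y'] (h : ScalarEnd K Y)
    (f : Y' ⊗ Y ⟶ 𝟙_ C) : ∃ a : K, f = a • ε_ Y Y' := by
  obtain ⟨a, ha⟩ := h.exists_smul (tensorLeftLinearEquiv K Y Y Y' (𝟙_ C) f ≫ (ρ_ Y).hom)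
  refine ⟨a, ?_⟩
  have h1 : tensorLeftLinearEquiv K Y Y Y' (𝟙_ C) (ε_ Y Y') = (ρ_ Y).inv := by
    change (λ_ _).inv ≫ η_ _ _ ▷ _ ≫ (α_ _ _ _).hom ≫ _ ◁ ε_ _ _ = _
    simp
  rw [← Iso.eq_comp_inv, Linear.smul_comp, Category.id_comp, ← h1, ← map_smul] at ha
  exact (tensorLeftLinearEquiv K _ _ _ _).injective ha

end Duals

end Semisimple

/-! ### Ribbon traces of tensor products and retracts -/

section Traces

variable {C : Type u} [Category.{v} C] [MonoidalCategory C]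

theorem exists_mate {Y Y' W W' : C} [ExactPairing Y Y'] [ExactPairing W W'] (ι : Y ⟶ W) :
    ∃ j : W' ⟶ Y', η_ W W' ≫ W ◁ j = η_ Y Y' ≫ ι ▷ Y' ∧ j ▷ Y ≫ ε_ Y Y' = W' ◁ ι ≫ ε_ W W' := by
  let hY : HasRightDual Y := ⟨Y'⟩
  let hW : HasRightDual W := ⟨W'⟩
  exact ⟨ιᘁ, coevaluation_comp_rightAdjointMate ι, rightAdjointMate_comp_evaluation ι⟩

variable [BraidedCategory C]

/-- A strand crossing both legs of a cap can be pulled off it, by naturality of the braiding and its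
triviality at the unit. -/
theorem braiding_slide {A B D : C} (e : B ⊗ D ⟶ 𝟙_ C) :
    (β_ A B).hom ▷ D ⊗≫ B ◁ (β_ A D).hom ⊗≫ e ▷ A = 𝟙 _ ⊗≫ A ◁ e ⊗≫ 𝟙 _ := by
  have h := BraidedCategory.braiding_naturality_right A e
  rw [braiding_tensorUnit_right, BraidedCategory.braiding_tensor_right_hom] at h
  calc _ = 𝟙 _ ⊗≫ (((α_ A B D).inv ≫ (β_ A B).hom ▷ D ≫ (α_ B A D).hom ≫
        B ◁ (β_ A D).hom ≫ (α_ B D A).inv) ≫ e ▷ A) := by monoidal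
    _ = _ := by
      rw [← h]
      monoidal

/-- The twisted evaluation of a tensor product. -/
theorem braiding_evaluation_tensor {A B A' B' : C} (a : A' ⊗ A ⟶ 𝟙_ C) (b : B' ⊗ B ⟶ 𝟙_ C) :
    ((β_ A B).hom ≫ (β_ B A).hom) ▷ (B' ⊗ A') ≫ (β_ (A ⊗ B) (B' ⊗ A')).hom ≫
        (𝟙 _ ⊗≫ B' ◁ (a ▷ B) ⊗≫ b) =
      𝟙 _ ⊗≫ A ◁ ((β_ B B').hom ≫ b) ▷ A' ⊗≫ (β_ A A').hom ≫ a := by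
  have h1 := BraidedCategory.braiding_naturality_left (β_ B A).hom B'
  have h2 := braiding_slide (A := B) ((β_ A A').hom ≫ a)
  have h3 := braiding_slide (A := A) ((β_ B B').hom ≫ b)
  calc _ = 𝟙 _ ⊗≫ (β_ A B).hom ▷ (B' ⊗ A') ⊗≫
        ((β_ B A).hom ▷ B' ≫ (β_ (A ⊗ B) B').hom) ▷ A' ⊗≫
          B' ◁ (β_ (A ⊗ B) A').hom ⊗≫ B' ◁ (a ▷ B) ⊗≫ b := by
        rw [BraidedCategory.braiding_tensor_right_hom (A ⊗ B) B' A']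
        monoidal
    _ = 𝟙 _ ⊗≫ (β_ A B).hom ▷ (B' ⊗ A') ⊗≫ (β_ (B ⊗ A) B').hom ▷ A' ⊗≫
          B' ◁ ((β_ B A).hom ▷ A' ⊗≫ A ◁ (β_ B A').hom ⊗≫ ((β_ A A').hom ≫ a) ▷ B) ⊗≫ b := by
        rw [h1, BraidedCategory.braiding_tensor_left_hom A B A']
        monoidal
    _ = 𝟙 _ ⊗≫ (β_ A B).hom ▷ (B' ⊗ A') ⊗≫ B ◁ (β_ A B').hom ▷ A' ⊗≫
          (β_ B B').hom ▷ (A ⊗ A') ⊗≫ ((B' ⊗ B) ◁ ((β_ A A').hom ≫ a) ≫ b ▷ 𝟙_ C) ⊗≫ 𝟙 _ := by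
        rw [h2, BraidedCategory.braiding_tensor_left_hom B A B']
        monoidal
    _ = 𝟙 _ ⊗≫ ((β_ A B).hom ▷ B' ⊗≫ B ◁ (β_ A B').hom ⊗≫
          ((β_ B B').hom ≫ b) ▷ A) ▷ A' ⊗≫ (β_ A A').hom ≫ a := by
        rw [whisker_exchange]
        monoidal
    _ = _ := by
        rw [h3]
        monoidal

variable [RightRigidCategory C] [RibbonCategory C]

/-- The mate of `ι` carries it around the loop, so the dimension of `Y` is the trace of the
idempotent `π ≫ ι` on `W`, for any choice of dual of `W`. -/
theorem ribbonTrace_of_retract {Y W W' : C} [ExactPairing W W'] {ι : Y ⟶ W} {π : W ⟶ Y}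
    (h : ι ≫ π = 𝟙 Y) :
    ribbonTrace (𝟙 Y) = η_ W W' ≫ (π ≫ ι) ▷ W' ≫ (RibbonCategory.twist W).hom ▷ W' ≫
      (β_ W W').hom ≫ ε_ W W' := by
  obtain ⟨j, h1, h2⟩ := exists_mate (Y' := Yᘁ) (W' := W') ι
  have hθ : (RibbonCategory.twist Y).hom = ι ≫ (RibbonCategory.twist W).hom ≫ π := by
    rw [← Category.assoc, RibbonCategory.twist_naturality, Category.assoc, h, Category.comp_id]
  have hnat : (π ≫ ι) ≫ (RibbonCategory.twist W).hom =
      (RibbonCategory.twist W).hom ≫ π ≫ ι := RibbonCategory.twist_naturality _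
  rw [ribbonTrace, Category.id_comp, hθ, comp_whiskerRight, Category.assoc, ← Category.assoc (η_ Y Yᘁ),
    ← h1, Category.assoc, whisker_exchange_assoc, BraidedCategory.braiding_naturality_right_assoc,
    h2, ← BraidedCategory.braiding_naturality_left_assoc, ← comp_whiskerRight_assoc,
    ← comp_whiskerRight_assoc, hnat, Category.assoc]

end Traces

/-! ### Dimensions as partial traces -/

section Dimensions

theorem partial_trace_tensor {C : Type u} [Category.{v} C] [MonoidalCategory C] {Z : C}
    [ExactPairing Z Z] (q : Z ⊗ Z ⟶ Z ⊗ Z) :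
    η_ (Z ⊗ Z) (Z ⊗ Z) ≫ q ▷ (Z ⊗ Z) ≫ (𝟙 _ ⊗≫ Z ◁ ε_ Z Z ▷ Z ⊗≫ ε_ Z Z) =
      η_ Z Z ≫ (ρ_ Z).inv ▷ Z ≫ ((Z ◁ η_ Z Z ≫ (α_ Z Z Z).inv) ≫ actLeft q ≫
        ((α_ Z Z Z).hom ≫ Z ◁ ε_ Z Z)) ▷ Z ≫ (ρ_ Z).hom ▷ Z ≫ ε_ Z Z := by
  rw [ExactPairing.tensor_coevaluation, actLeft]
  monoidal

variable {C : Type u} [Category.{v} C] [Preadditive C] [MonoidalCategory C]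
  [BraidedCategory C] [RightRigidCategory C] [RibbonCategory C]

/-- The twist of the unit is an invertible scalar, and `twist_tensor` makes it idempotent. -/
theorem twist_unit (K : Type w) [Field K] [Linear K C] [MonoidalPreadditive C] [MonoidalLinear K C]
    [SemisimpleCategory K C] : (RibbonCategory.twist (𝟙_ C)).hom = 𝟙 (𝟙_ C) := by
  obtain ⟨s, hs⟩ := (SemisimpleCategory.scalarEnd_unit (K := K) (C := C)).exists_smul
    (RibbonCategory.twist (𝟙_ C)).hom
  have h1 := RibbonCategory.twist_tensor (𝟙_ C) (𝟙_ C)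
  have h2 := RibbonCategory.twist_naturality (λ_ (𝟙_ C)).hom
  rw [h1, hs] at h2
  have h3 : s • (λ_ (𝟙_ C)).hom = (s * s) • (λ_ (𝟙_ C)).hom := by
    simpa [braiding_tensorUnit_left, smul_smul, unitors_equal, unitors_inv_equal,
      MonoidalCategory.tensorHom_def] using h2
  have h4 : s = s * s := by
    apply (SemisimpleCategory.scalarEnd_unit (K := K) (C := C)).1
    have := congrArg (fun f => (λ_ (𝟙_ C)).inv ≫ f) h3
    simpa using this
  have hs0 : s ≠ 0 := by
    rintro rfl
    rw [zero_smul] at hs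
    apply (SemisimpleCategory.scalarEnd_unit (K := K) (C := C)).id_ne_zero
    rw [← (RibbonCategory.twist (𝟙_ C)).hom_inv_id, hs, Limits.zero_comp]
  have : s = 1 := mul_left_cancel₀ hs0 (by rw [← h4, mul_one])
  rw [hs, this, one_smul]

variable {K : Type w} [Field K] [Linear K C] [SemisimpleCategory K C]

theorem catDim_eq_of_ribbonTrace {X : C} {a : K} (h : ribbonTrace (𝟙 X) = a • 𝟙 (𝟙_ C)) :
    catDim K X = a := by
  apply (SemisimpleCategory.scalarEnd_unit (K := K) (C := C)).1
  change catDim K X • 𝟙 (𝟙_ C) = _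
  rw [catDim_smul_id, h]

variable [MonoidalPreadditive C] [MonoidalLinear K C] {Z : C} [ExactPairing Z Z]

/-- For a self-dual object with chosen duality `η, ε` of loop value `δ`, the categorical
dimension is `±δ`, and the dimension of a direct summand of `Z ⊗ Z` is given by the partial trace
of its projection with respect to `η, ε`. -/
theorem exists_catDim_eq (hZ : ScalarEnd K Z) {δ : K}
    (hδ : η_ Z Z ≫ ε_ Z Z = δ • 𝟙 (𝟙_ C)) :
    ∃ ν : K, ν ^ 2 = 1 ∧ catDim K Z = ν * δ ∧
      ∀ (Y : C) (ι : Y ⟶ Z ⊗ Z) (π : Z ⊗ Z ⟶ Y), ι ≫ π = 𝟙 Y → ∀ x : K,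
        (Z ◁ η_ Z Z ≫ (α_ Z Z Z).inv) ≫ actLeft (π ≫ ι) ≫ ((α_ Z Z Z).hom ≫ Z ◁ ε_ Z Z) =
          x • 𝟙 (Z ⊗ 𝟙_ C) → catDim K Y = x * δ := by
  obtain ⟨t, ht⟩ := hZ.exists_smul (RibbonCategory.twist Z).hom
  obtain ⟨μ, hμ⟩ := hZ.exists_evaluation_smul ((β_ Z Z).hom ≫ ε_ Z Z)
  have hε : ε_ Z Z ≠ 0 := by
    intro h0
    have h1 := ExactPairing.evaluation_coevaluation Z Z
    rw [h0] at h1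
    apply hZ.id_ne_zero
    have := congrArg (fun f => (λ_ Z).inv ≫ f ≫ (ρ_ Z).hom) h1
    simpa using this.symm
  have hθ : (RibbonCategory.twist (Z ⊗ Z)).hom = (t ^ 2) • ((β_ Z Z).hom ≫ (β_ Z Z).hom) := by
    rw [RibbonCategory.twist_tensor, ht]
    simp [MonoidalCategory.tensorHom_def, smul_smul, pow_two]
  -- The twist is natural at `ε` and trivial on the unit, while on `Z ⊗ Z` it is `t²` times the
  -- double braiding, which `ε` sees as `t² μ²`.
  have hν : (t * μ) ^ 2 = 1 := by
    have h1 := RibbonCategory.twist_naturality (ε_ Z Z)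
    rw [twist_unit K, Category.comp_id, hθ, Linear.smul_comp, Category.assoc, hμ,
      Linear.comp_smul, hμ, smul_smul, smul_smul] at h1
    have h2 : (1 - t ^ 2 * (μ * μ)) • ε_ Z Z = 0 := by
      rw [sub_smul, one_smul, sub_eq_zero]
      rwa [mul_assoc] at h1
    rcases smul_eq_zero.1 h2 with h | h
    · linear_combination -h
    · exact (hε h).elim
  refine ⟨t * μ, hν, ?_, ?_⟩
  · apply catDim_eq_of_ribbonTrace
    rw [ribbonTrace_of_retract (W := Z) (W' := Z) (Category.id_comp (𝟙 Z)), Category.id_comp, ht, hμ]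
    simp only [MonoidalLinear.smul_whiskerRight, id_whiskerRight, Linear.smul_comp, Linear.comp_smul,
      Category.id_comp, hδ, smul_smul]
    congr 1
    ring
  · intro Y ι π hιπ x hx
    apply catDim_eq_of_ribbonTrace
    rw [ribbonTrace_of_retract (W := Z ⊗ Z) (W' := Z ⊗ Z) hιπ, hθ]
    have h1 := braiding_evaluation_tensor (ε_ Z Z) (ε_ Z Z)
    rw [hμ] at h1
    rw [ExactPairing.tensor_evaluation, MonoidalLinear.smul_whiskerRight, Linear.smul_comp, h1]
    have h2 := partial_trace_tensor (Z := Z) (π ≫ ι)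
    rw [hx] at h2
    simp only [monoidalComp, MonoidalLinear.smul_whiskerRight, MonoidalLinear.whiskerLeft_smul,
      Linear.smul_comp, Linear.comp_smul, smul_smul] at h2 ⊢
    rw [h2]
    have h3 : η_ Z Z ≫ (ρ_ Z).inv ▷ Z ≫ 𝟙 (Z ⊗ 𝟙_ C) ▷ Z ≫ (ρ_ Z).hom ▷ Z ≫ ε_ Z Z =
        δ • 𝟙 _ := by
      rw [← hδ]
      simp
    simp only [h3, smul_smul]
    congr 1
    linear_combination x * δ * hν

end Dimensions

/-! ### The projections as a basis of the endomorphism algebra -/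

section Decomposition

variable {C : Type u} [Category.{v} C] [Preadditive C] {d : ℕ} {X : C} {Y : Fin d → C}
  [HasBiproduct Y] (e : X ≅ ⨁ Y)

theorem sum_summandProj : ∑ i, summandProj e i = 𝟙 X := by
  have h : ∀ i, summandProj e i = e.hom ≫ (biproduct.π Y i ≫ biproduct.ι Y i) ≫ e.inv := by
    simp [summandProj]
  simp_rw [h, ← Preadditive.comp_sum, ← Preadditive.sum_comp, biproduct.total]
  simp

theorem ι_inv_comp_hom_π (i : Fin d) :
    (biproduct.ι Y i ≫ e.inv) ≫ e.hom ≫ biproduct.π Y i = 𝟙 (Y i) := by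
  simp

variable {K : Type w} [Field K] [Linear K C]

theorem linearIndependent_summandProj (hY : ∀ i, ScalarEnd K (Y i)) :
    LinearIndependent K (summandProj e) := by
  rw [Fintype.linearIndependent_iff]
  intro g hg j
  apply (hY j).1
  have := congrArg (fun f => (biproduct.ι Y j ≫ e.inv) ≫ f ≫ e.hom ≫ biproduct.π Y j) hg
  simp only [Preadditive.comp_sum, Preadditive.sum_comp] at this
  rw [Finset.sum_eq_single j] at this
  · simpa [summandProj] using this
  · intro i _ hij
    simp [summandProj, biproduct.ι_π_ne_assoc Y hij.symm]
  · simp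

theorem span_summandProj [MonoidalCategory C] [SemisimpleCategory K C]
    (hY : ∀ i, ScalarEnd K (Y i)) (hne : ∀ i j, i ≠ j → IsEmpty (Y i ≅ Y j)) :
    ⊤ ≤ Submodule.span K (Set.range (summandProj e)) := by
  rintro g -
  have hg : g = ∑ i, ∑ j, summandProj e i ≫ g ≫ summandProj e j := by
    simp_rw [← Preadditive.comp_sum, ← Preadditive.sum_comp, sum_summandProj,
      Category.id_comp, Category.comp_id]
  rw [hg]
  refine Submodule.sum_mem _ fun i _ => Submodule.sum_mem _ fun j _ => ?_
  have hij : summandProj e i ≫ g ≫ summandProj e j = (e.hom ≫ biproduct.π Y i) ≫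
      ((biproduct.ι Y i ≫ e.inv) ≫ g ≫ e.hom ≫ biproduct.π Y j) ≫ biproduct.ι Y j ≫ e.inv := by
    simp [summandProj]
  rw [hij]
  by_cases h : i = j
  · subst h
    obtain ⟨a, ha⟩ := (hY i).exists_smul ((biproduct.ι Y i ≫ e.inv) ≫ g ≫ e.hom ≫ biproduct.π Y i)
    rw [ha, Linear.smul_comp, Linear.comp_smul, Category.id_comp]
    exact Submodule.smul_mem _ _ (Submodule.subset_span ⟨i, rfl⟩)
  · have h0 := SemisimpleCategory.hom_eq_zero (hY i) (hY j) (hne i j h)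
      ((biproduct.ι Y i ≫ e.inv) ≫ g ≫ e.hom ≫ biproduct.π Y j)
    rw [h0, Limits.zero_comp, Limits.comp_zero]
    exact Submodule.zero_mem _

/-- Up to the normalization `P_r(λ_r)`, the polynomial `P_r` in the braiding is the projection onto
the `r`-th eigenspace. -/
theorem aeval_rightComp_polyP {W : C} {T : X ⟶ X} {q : Fin d → (X ⟶ X)} {lam : Fin d → K}
    (hsum : ∑ i, q i = 𝟙 X) (hq : ∀ i, q i ≫ T = lam i • q i) (r : Fin d) (f : W ⟶ X) :
    aeval (R := K) (A := Module.End K (W ⟶ X)) (Linear.rightComp K W T) (polyP lam r) f =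
      (polyP lam r).eval (lam r) • (f ≫ q r) := by
  have hf : f = ∑ i, f ≫ q i := by
    rw [← Preadditive.comp_sum, hsum, Category.comp_id]
  have heig : ∀ i, Linear.rightComp K W T (f ≫ q i) = lam i • (f ≫ q i) := by
    intro i
    rw [Linear.rightComp_apply, Category.assoc, hq, Linear.comp_smul]
  conv_lhs => rw [hf]
  rw [map_sum, Finset.sum_eq_single r]
  · exact aeval_apply_of_apply_eq_smul (heig r) _
  · intro i _ hir
    rw [aeval_apply_of_apply_eq_smul (heig i), eval_polyP_of_ne lam hir, zero_smul]
  · simp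

end Decomposition

section BraidAction

variable {K : Type w} [Field K] {C : Type u} [Category.{v} C] [Preadditive C] [Linear K C]
  [MonoidalCategory C] [BraidedCategory C] {Z : C}

theorem summandProj_comp_braiding {d : ℕ} {Y : Fin d → C} [HasBiproduct Y] (e : Z ⊗ Z ≅ ⨁ Y)
    {lam : Fin d → K}
    (hlam : ∀ i, (biproduct.ι Y i ≫ e.inv) ≫ (β_ Z Z).hom = lam i • (biproduct.ι Y i ≫ e.inv))
    (i : Fin d) : summandProj e i ≫ (β_ Z Z).hom = lam i • summandProj e i := by
  rw [summandProj, Category.assoc, hlam, Linear.comp_smul]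

theorem braidRep_braidGen (j : Fin 2) :
    braidRep K Z (braidGen j) = Linear.rightComp K Z (braidAut Z j).hom := by
  ext f
  rw [braidRep_braidGen_apply, Linear.rightComp_apply]

end BraidAction

/-! ### The compression identity and the braid module -/

section BraidModule

variable {K : Type w} [Field K] {C : Type u} [Category.{v} C] [Preadditive C] [Linear K C]
  [MonoidalCategory C] [SemisimpleCategory K C] {Z : C} {d : ℕ} {Y : Fin d → C} [HasBiproduct Y]

theorem exists_iso_unit (e : Z ⊗ Z ≅ ⨁ Y) (hZ : IsSelfDual K Z) (hY : ∀ i, ScalarEnd K (Y i)) :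
    ∃ i, Nonempty (Y i ≅ 𝟙_ C) := by
  obtain ⟨j, p, hjp, -⟩ := hZ
  have hp : p ≠ 0 := by
    rintro rfl
    rw [Limits.comp_zero] at hjp
    exact (SemisimpleCategory.scalarEnd_unit (K := K) (C := C)).id_ne_zero hjp.symm
  obtain ⟨i, hi⟩ : ∃ i, (biproduct.ι Y i ≫ e.inv) ≫ p ≠ 0 := by
    by_contra! h
    apply hp
    rw [← Category.id_comp p, ← sum_summandProj e, Preadditive.sum_comp]
    refine Finset.sum_eq_zero fun i _ => ?_
    rw [summandProj, Category.assoc, h, Limits.comp_zero]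
  have := isIso_of_ne_zero (hY i) SemisimpleCategory.scalarEnd_unit hi
  exact ⟨i, ⟨asIso ((biproduct.ι Y i ≫ e.inv) ≫ p)⟩⟩

variable [MonoidalPreadditive C] [MonoidalLinear K C] (e : Z ⊗ Z ≅ ⨁ Y)

/-- The compression of the projections onto the summands by the projection onto `𝟙_ C`. -/
theorem exists_compression [ExactPairing Z Z] (hZ : ScalarEnd K Z) {δ : K}
    (hδ : η_ Z Z ≫ ε_ Z Z = δ • 𝟙 (𝟙_ C)) {o : Fin d} (φ : Y o ≅ 𝟙_ C) :
    ∃ c : K, c * δ = 1 ∧ ∀ i, ∃ x : K,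
      (Z ◁ η_ Z Z ≫ (α_ Z Z Z).inv) ≫ actLeft (summandProj e i) ≫
        ((α_ Z Z Z).hom ≫ Z ◁ ε_ Z Z) = x • 𝟙 (Z ⊗ 𝟙_ C) ∧
      actRight (summandProj e o) ≫ actLeft (summandProj e i) ≫ actRight (summandProj e o) =
        (c * x) • actRight (summandProj e o) := by
  obtain ⟨a, ha⟩ := hZ.exists_evaluation_smul ((e.hom ≫ biproduct.π Y o) ≫ φ.hom)
  obtain ⟨b, hb⟩ := hZ.exists_coevaluation_smul (φ.inv ≫ biproduct.ι Y o ≫ e.inv)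
  -- Evaluations and coevaluations are unique up to scalars; idempotency normalizes the product by
  -- the loop value `δ`.
  have hp : summandProj e o = (a * b) • (ε_ Z Z ≫ η_ Z Z) := by
    have : summandProj e o = ((e.hom ≫ biproduct.π Y o) ≫ φ.hom) ≫
        φ.inv ≫ biproduct.ι Y o ≫ e.inv := by
      simp [summandProj]
    rw [this, ha, hb, Linear.smul_comp, Linear.comp_smul, smul_smul]
  have hab : (a * b) * δ = 1 := by
    have h1 : (φ.inv ≫ biproduct.ι Y o ≫ e.inv) ≫ (e.hom ≫ biproduct.π Y o) ≫ φ.hom = 𝟙 _ := by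
      simp
    rw [ha, hb, Linear.smul_comp, Linear.comp_smul, hδ, smul_smul, smul_smul] at h1
    apply (SemisimpleCategory.scalarEnd_unit (K := K) (C := C)).1
    change _ • 𝟙 (𝟙_ C) = (1 : K) • 𝟙 (𝟙_ C)
    rw [one_smul, ← h1]
    congr 1
    ring
  have hR : actRight (summandProj e o) = (a * b) •
      (((α_ Z Z Z).hom ≫ Z ◁ ε_ Z Z) ≫ Z ◁ η_ Z Z ≫ (α_ Z Z Z).inv) := by
    rw [actRight, hp]
    simp
  refine ⟨a * b, hab, fun i => ?_⟩
  obtain ⟨x, hx⟩ := (hZ.of_iso (ρ_ Z)).exists_smul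
    ((Z ◁ η_ Z Z ≫ (α_ Z Z Z).inv) ≫ actLeft (summandProj e i) ≫ ((α_ Z Z Z).hom ≫ Z ◁ ε_ Z Z))
  refine ⟨x, hx, ?_⟩
  have h2 : actRight (summandProj e o) ≫ actLeft (summandProj e i) ≫ actRight (summandProj e o) =
      ((a * b) * (a * b)) • (((α_ Z Z Z).hom ≫ Z ◁ ε_ Z Z) ≫
        ((Z ◁ η_ Z Z ≫ (α_ Z Z Z).inv) ≫ actLeft (summandProj e i) ≫
          ((α_ Z Z Z).hom ≫ Z ◁ ε_ Z Z)) ≫ Z ◁ η_ Z Z ≫ (α_ Z Z Z).inv) := by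
    rw [hR]
    simp [smul_smul]
  rw [h2, hx, hR, Linear.smul_comp, Linear.comp_smul, smul_smul, smul_smul, Category.id_comp]
  congr 1
  ring

variable [BraidedCategory C] {lam : Fin d → K}

theorem exists_isGenericBraidRep [ExactPairing Z Z] (hY : ∀ i, ScalarEnd K (Y i))
    (hne : ∀ i j, i ≠ j → IsEmpty (Y i ≅ Y j))
    (hlam : ∀ i, (biproduct.ι Y i ≫ e.inv) ≫ (β_ Z Z).hom = lam i • (biproduct.ι Y i ≫ e.inv))
    (hinj : Function.Injective lam) {o : Fin d} {t : Fin d → K} (ht : ∀ i, t i ≠ 0)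
    (hcomp : ∀ i, actRight (summandProj e o) ≫ actLeft (summandProj e i) ≫
      actRight (summandProj e o) = t i • actRight (summandProj e o)) :
    ∃ b, IsGenericBraidRep (braidRep K Z) b lam o
      fun i => (polyP lam o).eval (lam o) * (polyP lam i).eval (lam i) * t i := by
  have hq := summandProj_comp_braiding e hlam
  have hsum := sum_summandProj e
  have hL : ∑ i, actLeft (summandProj e i) = 𝟙 _ := by
    simp_rw [actLeft, ← sum_whiskerRight, hsum, id_whiskerRight]
  have hR : ∑ i, actRight (summandProj e i) = 𝟙 _ := by
    simp_rw [actRight, ← Preadditive.comp_sum, ← Preadditive.sum_comp, ← whiskerLeft_sum, hsum]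
    simp
  have hqL : ∀ i, actLeft (summandProj e i) ≫ (braidAut Z 0).hom =
      lam i • actLeft (summandProj e i) := by
    intro i
    rw [braidAut_zero_hom, actLeft, actLeft, ← comp_whiskerRight, hq,
      MonoidalLinear.smul_whiskerRight]
  have hqR : ∀ i, actRight (summandProj e i) ≫ (braidAut Z 1).hom =
      lam i • actRight (summandProj e i) := by
    intro i
    have : actRight (summandProj e i) ≫ actRight (β_ Z Z).hom =
        actRight (summandProj e i ≫ (β_ Z Z).hom) := by
      simp [actRight]
    rw [braidAut_one_hom, this, hq]
    simp [actRight]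
  -- Bending the last strand turns the basis of projections in `End(Z ⊗ Z)` into one of `V`.
  -- Composition with the braiding on the first two strands is unaffected.
  refine ⟨(Module.Basis.mk (linearIndependent_summandProj e hY) (span_summandProj e hY hne)).map
    (tensorRightLinearEquiv K Z Z Z (Z ⊗ Z)), ?_, ?_, hinj, ?_, ?_⟩
  · intro i
    rw [Module.Basis.map_apply, Module.Basis.mk_apply, braidRep_braidGen_apply, braidAut_zero_hom,
      ← map_smul, ← hq, tensorRightLinearEquiv_apply, tensorRightLinearEquiv_apply, actLeft]
    simp
  · intro i h0
    apply (hY i).id_ne_zero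
    have h1 := hlam i
    rw [h0, zero_smul, ← Limits.zero_comp (f := (β_ Z Z).hom), cancel_mono] at h1
    rw [← ι_inv_comp_hom_π e, h1, Limits.zero_comp]
  · intro i
    exact mul_ne_zero (mul_ne_zero (eval_polyP_self_ne_zero hinj o)
      (eval_polyP_self_ne_zero hinj i)) (ht i)
  · intro i
    ext f
    simp only [braidRep_braidGen, Module.End.mul_apply, LinearMap.smul_apply]
    rw [aeval_rightComp_polyP hR hqR, aeval_rightComp_polyP hL hqL, aeval_rightComp_polyP hR hqR]
    simp only [Linear.smul_comp, Category.assoc, hcomp, Linear.comp_smul, smul_smul]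
    congr 1
    ring

end BraidModule

end BraidDim

end

theorem mainTheorem11 {K : Type w} [Field K] [IsAlgClosed K]
    {C : Type u} [Category.{v} C] [Preadditive C] [Linear K C]
    [MonoidalCategory C] [MonoidalPreadditive C] [MonoidalLinear K C]
    [BraidedCategory C] [RightRigidCategory C] [RibbonCategory C] [SemisimpleCategory K C]
    (Z : C) [Simple Z] (hZ : IsSelfDual K Z)
    (d : ℕ) (Y : Fin d → C) [HasBiproduct Y] (e : Z ⊗ Z ≅ ⨁ Y)
    (hsimple : ∀ i, Simple (Y i))
    (hnoniso : ∀ i j, i ≠ j → IsEmpty (Y i ≅ Y j))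
    (hdim : ∀ i, catDim K (Y i) ≠ 0)
    (lam : Fin d → K)
    (hlam : ∀ i, (biproduct.ι Y i ≫ e.inv) ≫ (β_ Z Z).hom = lam i • (biproduct.ι Y i ≫ e.inv))
    (hinj : Function.Injective lam) :
    -- the lemma
    ((braidRep K Z).IsIrreducible ∧ Module.finrank K (Z ⟶ cube Z) = d ∧
      ∀ j : Fin 2,
        (∀ μ : K, Module.End.HasEigenvalue (braidRep K Z (braidGen j)) μ ↔ ∃ i, μ = lam i) ∧
        ∀ i, Module.finrank K (Module.End.maxGenEigenspace (braidRep K Z (braidGen j)) (lam i)) = 1) ∧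
    -- the corollary
    (∃ i₁, Nonempty (Y i₁ ≅ 𝟙_ C)) ∧ ∀ i₁, Nonempty (Y i₁ ≅ 𝟙_ C) →
      (∀ i, catDim K (Y i) • actRight (summandProj e i₁) =
        (catDim K Z) ^ 2 • (actRight (summandProj e i₁) ≫ actLeft (summandProj e i) ≫
          actRight (summandProj e i₁))) ∧
      ∃ Q : Fin d → Fin d → K, IsQFamily (braidRep K Z) lam Q ∧
        ∀ i, catDim K (Y i) = Q i₁ i * (catDim K Z) ^ 2 /
          ((polyP lam i₁).eval (lam i₁) * (polyP lam i).eval (lam i)) := by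
  have hY : ∀ i, ScalarEnd K (Y i) := fun i => by
    have := hsimple i
    exact scalarEnd_of_simple K (Y i)
  have hZs : ScalarEnd K Z := scalarEnd_of_simple K Z
  obtain ⟨_⟩ := exists_exactPairing_self hZs hZ
  obtain ⟨δ, hδ⟩ :=
    (SemisimpleCategory.scalarEnd_unit (K := K) (C := C)).exists_smul (η_ Z Z ≫ ε_ Z Z)
  obtain ⟨ν, hν, hdimZ, hdimY⟩ := exists_catDim_eq hZs hδ
  have key : ∀ o, Nonempty (Y o ≅ 𝟙_ C) →
      catDim K Z ≠ 0 ∧ (∀ i, actRight (summandProj e o) ≫ actLeft (summandProj e i) ≫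
        actRight (summandProj e o) =
          (catDim K (Y i) / catDim K Z ^ 2) • actRight (summandProj e o)) ∧
      ∃ b, IsGenericBraidRep (braidRep K Z) b lam o fun i =>
        (polyP lam o).eval (lam o) * (polyP lam i).eval (lam i) *
          (catDim K (Y i) / catDim K Z ^ 2) := by
    rintro o ⟨φ⟩
    obtain ⟨c, hc, hx⟩ := exists_compression e hZs hδ φ
    have hδ0 : δ ≠ 0 := right_ne_zero_of_mul_eq_one hc
    have hν0 : ν ≠ 0 := by
      rintro rfl
      simp at hν
    have hZ0 : catDim K Z ≠ 0 := by
      rw [hdimZ]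
      exact mul_ne_zero hν0 hδ0
    have hcomp : ∀ i, actRight (summandProj e o) ≫ actLeft (summandProj e i) ≫
        actRight (summandProj e o) =
          (catDim K (Y i) / catDim K Z ^ 2) • actRight (summandProj e o) := by
      intro i
      obtain ⟨x, hx1, hx2⟩ := hx i
      rw [hx2, hdimY (Y i) _ _ (ι_inv_comp_hom_π e i) x hx1, hdimZ, mul_pow, hν, one_mul]
      -- Here `c x = x δ / δ²`, because `c δ = 1`, and `δ² = (dim Z)²` because `ν² = 1`.
      congr 1
      field_simp
      linear_combination x * hc
    exact ⟨hZ0, hcomp, exists_isGenericBraidRep e hY hnoniso hlam hinj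
      (fun i => div_ne_zero (hdim i) (pow_ne_zero 2 hZ0)) hcomp⟩
  have hex := exists_iso_unit e hZ hY
  refine ⟨?_, hex, fun o ho => ?_⟩
  · obtain ⟨o, ho⟩ := hex
    obtain ⟨-, -, b, hb⟩ := key o ho
    refine ⟨hb.isIrreducible, by rw [Module.finrank_eq_card_basis b, Fintype.card_fin],
      fun j => ?_⟩
    obtain ⟨b', hb'⟩ := hb.exists_basis_braidGen j
    exact ⟨hasEigenvalue_iff_of_basis hb', finrank_maxGenEigenspace_of_basis hinj hb'⟩
  · obtain ⟨hZ0, hcomp, b, hb⟩ := key o ho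
    obtain ⟨Q, hQ, hQo⟩ := hb.exists_isQFamily
    refine ⟨fun i => ?_, Q, hQ, fun i => ?_⟩
    · rw [hcomp, smul_smul, mul_div_cancel₀ _ (pow_ne_zero 2 hZ0)]
    · have h1 := eval_polyP_self_ne_zero hinj o
      have h2 := eval_polyP_self_ne_zero hinj i
      rw [hQo]
      field_simp
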